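/- Let $n\ge 1$ and let $S\subseteq\{0,1\}^n$ be a set whose convex hull in $\mathbb{R}^n$ is a simplex (of any dimension) containing the point $\tfrac12\cdot\mathbf 1=(\tfrac12,\dots,\tfrac12)$ in its relative interior. Then exactly one of the following two statements holds: (1) the clutter $\mathrm{cuboid}(S)$ has a minor that is a delta or the blocker of an extended odd hole; (2) $S$ is a duplication of the cocycle space of $PG(k-1,2)$ for some integer $k\ge 1$. Here the following terminology is used. A clutter is a finite ground set $V$ with a family of subsets of $V$, called members, none of which contains another. A cover is a subset of $V$ that meets every member; the blocker of a clutter is the clutter over $V$ whose members are the inclusion-wise minimal covers. For disjoint $I,J\subseteq V$, the minor $\mathcal C\setminus I/J$ is the clutter over $V\setminus(I\cup J)$ whose members are the inclusion-wise minimal sets in $\{C\setminus J: C\in\mathcal C,\ C\cap I=\emptyset\}$. A delta is a clutter over a ground set $\{a_1,\dots,a_m\}$, $m\ge3$, whose members are $\{a_2,\dots,a_m\}$ and $\{a_1,a_i\}$ for $i=2,\dots,m$. An extended odd hole is a clutter over a ground set $\{a_1,\dots,a_m\}$, $m\ge5$ odd, whose members of minimum cardinality are exactly $\{a_1,a_2\},\{a_2,a_3\},\dots,\{a_{m-1},a_m\},\{a_m,a_1\}$.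 The clutter $\mathrm{cuboid}(S)$ has ground set $\{1,\dots,2n\}$, and its members are the sets with incidence vectors $(p_1,1-p_1,\dots,p_n,1-p_n)$, $p\in S$. For $k\ge1$, the cocycle space of $PG(k-1,2)$ (the rank-$k$ projective geometry over $GF(2)$) is the row space over $GF(2)$, viewed as a subset of $\{0,1\}^{2^k-1}$, of the $k\times(2^k-1)$ matrix whose columns are the nonzero vectors of $\{0,1\}^k$, each occurring once. Finally, $S\subseteq\{0,1\}^n$ is a duplication of $T\subseteq\{0,1\}^m$ if it is obtained from $T$ by duplicating, relabelling and twisting (complementing) coordinates, that is, if there are a surjection $f:\{1,\dots,n\}\to\{1,\dots,m\}$ and $t\in\{0,1\}^n$ such that $S=\{(x_{f(1)}+t_1,\dots,x_{f(n)}+t_n) \bmod 2 : x\in T\}$. -/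

import Mathlib

/-- A clutter: a finite ground set together with a family of subsets of the ground set,
none of which contains another one. -/
structure Clutter (α : Type*) where
  ground : Finset α
  members : Set (Finset α)
  subset_ground : ∀ C ∈ members, C ⊆ ground
  antichain : IsAntichain (· ⊆ ·) members

namespace Clutter

variable {α : Type*} [DecidableEq α]

/-- A cover is a subset of the ground set that meets every member. -/
def IsCover (C : Clutter α) (B : Finset α) : Prop :=
  B ⊆ C.ground ∧ ∀ A ∈ C.members, (A ∩ B).Nonempty

/-- The blocker `b(C)`: the clutter of the (inclusion-wise) minimal covers, over the same
ground set. -/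
def blocker (C : Clutter α) : Clutter α where
  ground := C.ground
  members := {B | Minimal C.IsCover B}
  subset_ground := fun _ hB => hB.prop.1
  antichain := fun _ hA _ hB hne hle => hne (hB.eq_of_le hA.prop hle)

/-- `B` is of the form `A - J` for a member `A` disjoint from `I`. -/
def IsRemnant (C : Clutter α) (I J B : Finset α) : Prop :=
  ∃ A ∈ C.members, Disjoint A I ∧ B = A \ J

/-- The minor `C \ I / J` obtained by deleting `I` and contracting `J` (meant for disjoint
subsets `I`, `J` of the ground set): its members are the inclusion-wise minimal sets among
the `A - J`, where `A` is a member disjoint from `I`. -/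
def minor (C : Clutter α) (I J : Finset α) : Clutter α where
  ground := C.ground \ (I ∪ J)
  members := {B | Minimal (C.IsRemnant I J) B}
  subset_ground := by
    intro B hB x hx
    obtain ⟨A, hA, hAI, rfl⟩ := hB.prop
    rw [Finset.mem_sdiff] at hx
    simp only [Finset.mem_sdiff, Finset.mem_union, not_or]
    exact ⟨C.subset_ground A hA hx.1, fun h => Finset.disjoint_left.mp hAI hx.1 h, hx.2⟩
  antichain := fun _ hA _ hB hne hle => hne (hB.eq_of_le hA.prop hle)

/-- `C` has a minor with the property `P`. -/
def HasMinor (C : Clutter α) (P : Clutter α → Prop) : Prop :=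
  ∃ I J : Finset α, I ⊆ C.ground ∧ J ⊆ C.ground ∧ Disjoint I J ∧ P (C.minor I J)

/-- A delta: at least three elements, and for some element `a` the members are the set of all
elements other than `a`, and the pairs `{a, b}` for the elements `b` other than `a`. -/
def IsDelta (C : Clutter α) : Prop :=
  3 ≤ C.ground.card ∧ ∃ a ∈ C.ground,
    C.members = {C.ground.erase a} ∪ {A | ∃ b ∈ C.ground.erase a, A = {a, b}}

/-- An extended odd hole: the ground set can be labelled cyclically `a₁, …, aₙ` with `n ≥ 5`
odd so that the members of minimum cardinality are exactly `{a₁, a₂}, …, {aₙ₋₁, aₙ}, {aₙ, a₁}`.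
There may be further members. -/
def IsExtendedOddHole (C : Clutter α) : Prop :=
  ∃ n : ℕ, 5 ≤ n ∧ Odd n ∧ ∃ a : ZMod n → α, Function.Injective a ∧
    (∀ x, x ∈ C.ground ↔ ∃ i, a i = x) ∧
    {A | A ∈ C.members ∧ ∀ B ∈ C.members, A.card ≤ B.card} = {A | ∃ i, A = {a i, a (i + 1)}}

/-- The blocker of an extended odd hole. -/
def IsBlockerOfExtendedOddHole (D : Clutter α) : Prop :=
  ∃ C : Clutter α, C.IsExtendedOddHole ∧ D = C.blocker

end Clutter

/-- The member of the cuboid that belongs to the point `p` of `{0,1}^n`. The pair of elements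
`2i - 1`, `2i` of the ground set `[2n]` is written `(i, true)`, `(i, false)`: the first lies in
the member iff `p i = 1`, the second iff `p i = 0`. -/
def cuboidMember {n : ℕ} (p : Fin n → ZMod 2) : Finset (Fin n × Bool) :=
  Finset.univ.filter fun e => p e.1 = if e.2 then 1 else 0

theorem cuboidMember_eq_of_subset {n : ℕ} {p q : Fin n → ZMod 2}
    (h : cuboidMember p ⊆ cuboidMember q) : p = q := by
  funext i
  have h2 : ∀ x : ZMod 2, x = 0 ∨ x = 1 := by decide
  rcases h2 (p i) with hp | hp
  · have : (i, false) ∈ cuboidMember p := by simp [cuboidMember, hp]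
    have := h this
    simp only [cuboidMember, Finset.mem_filter] at this
    simpa [hp] using this.2.symm
  · have : (i, true) ∈ cuboidMember p := by simp [cuboidMember, hp]
    have := h this
    simp only [cuboidMember, Finset.mem_filter] at this
    simpa [hp] using this.2.symm

/-- The cuboid of a set `S ⊆ {0,1}^n`: the clutter over `2n` elements whose members have the
incidence vectors `(p₁, 1 - p₁, …, pₙ, 1 - pₙ)` for `p ∈ S`. -/
def cuboid {n : ℕ} (S : Set (Fin n → ZMod 2)) : Clutter (Fin n × Bool) where
  ground := Finset.univ
  members := cuboidMember '' S
  subset_ground := fun _ _ => Finset.subset_univ _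
  antichain := by
    rintro _ ⟨p, _, rfl⟩ _ ⟨q, _, rfl⟩ hne hle
    exact hne (congrArg cuboidMember (cuboidMember_eq_of_subset hle))

/-- The point of `ℝ^ι` with the same 0-1 coordinates as `p`. -/
def toRealPoint {ι : Type*} (p : ι → ZMod 2) : ι → ℝ := fun i => ((p i).val : ℝ)

/-- The convex hull in real space of a set of 0-1 points. -/
def realConvexHull {ι : Type*} (S : Set (ι → ZMod 2)) : Set (ι → ℝ) :=
  convexHull ℝ (toRealPoint '' S)

/-- A simplex (of some dimension `d ≥ 0`): the convex hull of `d + 1` affinely independent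
points. -/
def IsSimplex {ι : Type*} (K : Set (ι → ℝ)) : Prop :=
  ∃ d : ℕ, ∃ v : Fin (d + 1) → (ι → ℝ), AffineIndependent ℝ v ∧ K = convexHull ℝ (Set.range v)

/-- The `k × (2^k - 1)` matrix over `GF(2)` whose columns are the nonzero vectors of length
`k`, each occurring once; it represents `PG(k-1,2)`. -/
def pgMatrix (k : ℕ) : Matrix (Fin k) {a : Fin k → ZMod 2 // a ≠ 0} (ZMod 2) :=
  Matrix.of fun j a => a.1 j

/-- The cocycle space of `PG(k-1,2)`: the row space over `GF(2)` of the matrix above. -/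
def cocyclePG (k : ℕ) : Set ({a : Fin k → ZMod 2 // a ≠ 0} → ZMod 2) :=
  {x | ∃ y : Fin k → ZMod 2, x = Matrix.mulVec (pgMatrix k).transpose y}

/-- `S` is a duplication of `T`: it is obtained from `T` by duplicating, relabelling and
twisting coordinates. Coordinate `i` of `S` is a copy of coordinate `f i` of `T`, complemented
when `t i = 1`; every coordinate of `T` keeps at least one copy. -/
def IsDuplication {ι κ : Type*} (S : Set (ι → ZMod 2)) (T : Set (κ → ZMod 2)) : Prop :=
  ∃ f : ι → κ, Function.Surjective f ∧ ∃ t : ι → ZMod 2, S = (fun x i => x (f i) + t i) '' T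

/-! The argument works with the covers of the cuboid: sets of literals (a coordinate together with a
value) such that every point of `S` satisfies one of them. Deletion in a clutter is contraction in
its covers, and a delta is its own blocker. So the required minor is a delta or an extended odd hole
obtained from the covers by contraction and restriction (`Obstructed`, `hasMinor_of_obstructed`).

Suppose there is none. If no single literal is a cover, the two-literal covers form a bipartite
graph, and no colour class of a component is a cover (`obstructed_of_monochromatic`). Falsifying all
literals of one class, or all of the other, gives two nonempty parts of `S` on which the coordinates
of the component are constant with opposite values. Induction on both parts and averaging give a
probability distribution on `S` with unbiased coordinates (`exists_balanced`).

The geometric hypotheses say that such a distribution `μ` is unique and positive on `S`. Balanced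
distributions on the two facets of a coordinate average to `μ`, so they are its conditional
distributions and inherit uniqueness (`IsUniquelyBalanced.facet`). Hence coordinates that are
neither equal nor complementary on `S` are uncorrelated. If no third coordinate were the sum of two
such coordinates up to a constant, the product of their characters with `μ` would be orthogonal to
the constants and to all coordinates, against affine independence (`exists_add_const`). So the
normalized coordinates and zero form a vector space over GF(2), and a Fourier argument shows that
every functional on it is evaluation at a point of `S` (`exists_isDuplication`).

The alternatives exclude each other because a duplication is closed under sums of three points. Its
cuboid is therefore binary, as are all minors of it, while a delta or the blocker of an extended odd
hole is not. -/

/-! ### Covers, blockers and minors -/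

/-- Two clutters with the same ground set and the same members are equal. -/
theorem Clutter.eq_of_ground_of_members {α : Type*} {C D : Clutter α} (hg : C.ground = D.ground)
    (hm : C.members = D.members) : C = D := by
  cases C; cases D; simp_all

namespace Clutter

theorem IsCover.exists_blocker_subset {α : Type*} [DecidableEq α] {C : Clutter α} {T : Finset α}
    (h : C.IsCover T) : ∃ B ∈ C.blocker.members, B ⊆ T := by
  obtain ⟨B, hB, hm⟩ := exists_minimal_le_of_wellFoundedLT C.IsCover T h
  exact ⟨B, hm, hB⟩

/-- Complementation exchanges containing a member and failing to cover; both the involutivity of the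
blocker and the self-duality of deltas rest on this. -/
theorem exists_member_subset_iff {α : Type*} [DecidableEq α] (C : Clutter α) (X : Finset α) :
    (∃ A ∈ C.members, A ⊆ X) ↔ ¬ C.IsCover (C.ground \ X) := by
  constructor
  · rintro ⟨A, hA, hAX⟩ hc
    obtain ⟨x, hx⟩ := hc.2 A hA
    simp only [Finset.mem_inter, Finset.mem_sdiff] at hx
    exact hx.2.2 (hAX hx.1)
  · intro h
    by_contra! hX
    refine h ⟨Finset.sdiff_subset, fun A hA => ?_⟩
    obtain ⟨x, hxA, hxX⟩ := Finset.not_subset.mp (hX A hA)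
    exact ⟨x, by simp [hxA, hxX, C.subset_ground A hA hxA]⟩

theorem mem_members_iff {α : Type*} [DecidableEq α] (C : Clutter α) (X : Finset α) :
    X ∈ C.members ↔ Minimal (fun Y => ∃ A ∈ C.members, A ⊆ Y) X := by
  constructor
  · intro hX
    refine ⟨⟨X, hX, subset_rfl⟩, ?_⟩
    rintro Y ⟨A, hA, hAY⟩ hYX
    have : A = X := C.antichain.eq hA hX (hAY.trans hYX)
    exact this ▸ hAY
  · rintro ⟨⟨A, hA, hAX⟩, hmin⟩
    have : X ⊆ A := hmin ⟨A, hA, subset_rfl⟩ hAX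
    exact (hAX.antisymm this) ▸ hA

theorem blocker_isCover_iff {α : Type*} [DecidableEq α] (C : Clutter α) (X : Finset α) :
    C.blocker.IsCover X ↔ X ⊆ C.ground ∧ ∃ A ∈ C.members, A ⊆ X := by
  constructor
  · rintro ⟨hX, h⟩
    refine ⟨hX, (C.exists_member_subset_iff X).mpr fun hc => ?_⟩
    obtain ⟨B, hB, hBX⟩ := hc.exists_blocker_subset
    obtain ⟨x, hx⟩ := h B hB
    rw [Finset.mem_inter] at hx
    exact (Finset.mem_sdiff.mp (hBX hx.1)).2 hx.2
  · rintro ⟨hX, A, hA, hAX⟩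
    refine ⟨hX, fun B hB => ?_⟩
    have := hB.prop.2 A hA
    rw [Finset.inter_comm] at this
    exact this.mono (Finset.inter_subset_inter_left hAX)

theorem blocker_blocker {α : Type*} [DecidableEq α] (C : Clutter α) : C.blocker.blocker = C := by
  refine eq_of_ground_of_members rfl (Set.ext fun X => ?_)
  rw [mem_members_iff C]
  constructor
  · rintro hX
    have h1 : Minimal C.blocker.IsCover X := hX
    obtain ⟨h, hmin⟩ := h1
    have h2 := (blocker_isCover_iff C X).mp h
    exact ⟨h2.2, fun Y hY hYX => hmin ((blocker_isCover_iff C Y).mpr ⟨hYX.trans h2.1, hY⟩) hYX⟩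
  · rintro hX
    have hX' := hX
    rw [← mem_members_iff] at hX'
    have : Minimal C.blocker.IsCover X :=
      ⟨(blocker_isCover_iff C X).mpr ⟨C.subset_ground X hX', hX.prop⟩,
        fun Y hY hYX => hX.2 ((blocker_isCover_iff C Y).mp hY).2 hYX⟩
    exact this

/-- The members lost in the deletion are those that meet `I`, so adding `I` to `T` meets them for
free, and `T` avoids the contracted `J`. This turns questions about minors into questions about one
monotone family. -/
theorem minor_isCover_iff {α : Type*} [DecidableEq α] (C : Clutter α) (I J T : Finset α)
    (hT : T ⊆ C.ground \ (I ∪ J)) :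
    (C.minor I J).IsCover T ↔ ∀ A ∈ C.members, (A ∩ (I ∪ T)).Nonempty := by
  have hTJ : ∀ x ∈ T, x ∉ J := fun x hx h => by
    have := hT hx
    simp_all
  constructor
  · rintro ⟨-, h⟩ A hA
    by_cases hAI : Disjoint A I
    · obtain ⟨B, hB, hm⟩ :=
        exists_minimal_le_of_wellFoundedLT (C.IsRemnant I J) (A \ J) ⟨A, hA, hAI, rfl⟩
      obtain ⟨x, hx⟩ := h B hm
      rw [Finset.mem_inter] at hx
      exact ⟨x, by simp [(Finset.mem_sdiff.mp (hB hx.1)).1, hx.2]⟩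
    · rw [Finset.not_disjoint_iff_nonempty_inter] at hAI
      exact hAI.mono (Finset.inter_subset_inter_left Finset.subset_union_left)
  · intro h
    refine ⟨hT, fun B hB => ?_⟩
    obtain ⟨A, hA, hAI, rfl⟩ := hB.prop
    obtain ⟨x, hx⟩ := h A hA
    rw [Finset.mem_inter, Finset.mem_union] at hx
    have hxI : x ∉ I := fun hI => Finset.disjoint_left.mp hAI hx.1 hI
    have hxT := hx.2.resolve_left hxI
    exact ⟨x, by simp [hx.1, hxT, hTJ x hxT]⟩

end Clutter

/-! ### Obstructions in monotone families -/

/-- Contracting `I` and restricting to `W` turns the family `P` of covers into the sets that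
contain a member of a delta. -/
def DeltaOn {α : Type*} [DecidableEq α] (P : Finset α → Prop) (I W : Finset α) : Prop :=
  3 ≤ W.card ∧ ∃ a ∈ W, ∀ T ⊆ W,
    P (I ∪ T) ↔ (W.erase a ⊆ T ∨ ∃ b ∈ W.erase a, {a, b} ⊆ T)

/-- Contracting `I` and restricting to `W` turns the family `P` of covers into the sets that
contain a member of an extended odd hole. -/
def OddHoleOn {α : Type*} [DecidableEq α] (P : Finset α → Prop) (I W : Finset α) : Prop :=
  ∃ n : ℕ, 5 ≤ n ∧ Odd n ∧ ∃ a : ZMod n → α, Function.Injective a ∧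
    (∀ x, x ∈ W ↔ ∃ i, a i = x) ∧ (∀ T ⊆ W, P (I ∪ T) → 2 ≤ T.card) ∧
    ∀ T ⊆ W, T.card = 2 → (P (I ∪ T) ↔ ∃ i, T = {a i, a (i + 1)})

/-- The family `P` has, after contraction and restriction, a delta or an extended odd hole. -/
def Obstructed {α : Type*} [DecidableEq α] (P : Finset α → Prop) : Prop :=
  ∃ I W, DeltaOn P I W ∨ OddHoleOn P I W

theorem Obstructed.of_contract {α : Type*} [DecidableEq α] {P : Finset α → Prop} {I₀ : Finset α}
    (h : Obstructed fun T => P (I₀ ∪ T)) : Obstructed P := by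
  obtain ⟨I, W, h⟩ := h
  refine ⟨I₀ ∪ I, W, ?_⟩
  simpa only [DeltaOn, OddHoleOn, Finset.union_assoc] using h

/-- A common element would cost nothing, so a pair of the delta would shrink to a singleton in the
family. -/
theorem DeltaOn.disjoint {α : Type*} [DecidableEq α] {P : Finset α → Prop} {I W : Finset α}
    (h : DeltaOn P I W) : Disjoint I W := by
  obtain ⟨h3, a, ha, hP⟩ := h
  have hna : ∀ b ∈ W, ¬ P (I ∪ {b}) := by
    intro b hb hPb
    rcases (hP {b} (by simpa using hb)).mp hPb with h | ⟨c, hc, h⟩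
    · have := Finset.card_le_card h
      rw [Finset.card_erase_of_mem ha, Finset.card_singleton] at this
      omega
    · have h1 : a = b := by simpa using h (by simp : a ∈ ({a, c} : Finset α))
      have h2 : c = b := by simpa using h (by simp : c ∈ ({a, c} : Finset α))
      exact (Finset.mem_erase.mp hc).1 (h2.trans h1.symm)
  have hpair : ∀ b ∈ W.erase a, P (I ∪ {a, b}) := fun b hb =>
    (hP {a, b} (by
      intro x hx
      simp only [Finset.mem_insert, Finset.mem_singleton] at hx
      rcases hx with rfl | rfl
      exacts [ha, Finset.mem_of_mem_erase hb])).mpr (Or.inr ⟨b, hb, subset_rfl⟩)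
  rw [Finset.disjoint_left]
  intro x hxI hxW
  by_cases hxa : x = a
  · subst hxa
    obtain ⟨b, hb⟩ : (W.erase x).Nonempty := by
      rw [← Finset.card_pos, Finset.card_erase_of_mem ha]; omega
    refine hna b (Finset.mem_of_mem_erase hb) ?_
    have := hpair b hb
    rwa [show I ∪ {x, b} = I ∪ {b} by ext y; simp; grind] at this
  · refine hna a ha ?_
    have := hpair x (Finset.mem_erase.mpr ⟨hxa, hxW⟩)
    rwa [show I ∪ {a, x} = I ∪ {a} by ext y; simp; grind] at this

theorem OddHoleOn.disjoint {α : Type*} [DecidableEq α] {P : Finset α → Prop} {I W : Finset α}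
    (h : OddHoleOn P I W) : Disjoint I W := by
  obtain ⟨n, h5, -, a, ha, hW, hcard, hP⟩ := h
  have : Fact (1 < n) := ⟨by omega⟩
  rw [Finset.disjoint_left]
  intro x hxI hxW
  obtain ⟨i, rfl⟩ := (hW x).mp hxW
  have hne : a i ≠ a (i + 1) := fun h => by simpa using ha h
  have h1 : P (I ∪ {a i, a (i + 1)}) := by
    refine (hP _ ?_ (Finset.card_pair hne)).mpr ⟨i, rfl⟩
    intro y hy
    simp only [Finset.mem_insert, Finset.mem_singleton] at hy
    rcases hy with rfl | rfl <;> exact (hW _).mpr ⟨_, rfl⟩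
  rw [show I ∪ {a i, a (i + 1)} = I ∪ {a (i + 1)} by ext y; simp; grind] at h1
  have := hcard _ (by simpa using (hW _).mpr ⟨_, rfl⟩) h1
  simp at this

namespace Clutter

/-- A delta equals its own blocker (this is `key`), so prescribing the covers prescribes the
members. -/
theorem isDelta_of_isCover_iff {α : Type*} [DecidableEq α] {M : Clutter α} {a : α}
    (h3 : 3 ≤ M.ground.card) (ha : a ∈ M.ground)
    (hM : ∀ T ⊆ M.ground, M.IsCover T ↔
      (M.ground.erase a ⊆ T ∨ ∃ b ∈ M.ground.erase a, {a, b} ⊆ T)) : M.IsDelta := by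
  refine ⟨h3, a, ha, Set.ext fun X => ?_⟩
  obtain ⟨b₀, hb₀⟩ : (M.ground.erase a).Nonempty := by
    rw [← Finset.card_pos, Finset.card_erase_of_mem ha]; omega
  have key : ∀ Y, (∃ A ∈ M.members, A ⊆ Y) ↔
      (M.ground.erase a ⊆ Y ∨ ∃ b ∈ M.ground.erase a, {a, b} ⊆ Y) := by
    intro Y
    rw [exists_member_subset_iff, hM _ Finset.sdiff_subset]
    push Not
    constructor
    · rintro ⟨h1, h2⟩
      obtain ⟨b, hb, hbY⟩ := Finset.not_subset.mp h1
      have hbY : b ∈ Y := by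
        by_contra hn
        exact hbY (Finset.mem_sdiff.mpr ⟨Finset.mem_of_mem_erase hb, hn⟩)
      by_cases haY : a ∈ Y
      · exact Or.inr ⟨b, hb, by simp [Finset.insert_subset_iff, haY, hbY]⟩
      · refine Or.inl fun c hc => ?_
        by_contra hcY
        refine h2 c hc ?_
        simp [Finset.insert_subset_iff, haY, hcY, ha, Finset.mem_of_mem_erase hc]
    · rintro (h | ⟨b, hb, h⟩)
      · refine ⟨fun h' => (Finset.mem_sdiff.mp (h' hb₀)).2 (h hb₀), fun b hb h' => ?_⟩
        exact (Finset.mem_sdiff.mp (h' (by simp : b ∈ ({a, b} : Finset α)))).2 (h hb)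
      · refine ⟨fun h' => (Finset.mem_sdiff.mp (h' hb)).2 (h (by simp)), fun c hc h' => ?_⟩
        exact (Finset.mem_sdiff.mp (h' (by simp : a ∈ ({a, c} : Finset α)))).2 (h (by simp))
  rw [mem_members_iff]
  simp only [key]
  simp only [Set.mem_union, Set.mem_singleton_iff, Set.mem_ofPred_eq]
  constructor
  · rintro ⟨h | ⟨b, hb, h⟩, hmin⟩
    · exact Or.inl ((hmin (Or.inl subset_rfl) h).antisymm h)
    · exact Or.inr ⟨b, hb, (hmin (Or.inr ⟨b, hb, subset_rfl⟩) h).antisymm h⟩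
  · rintro (rfl | ⟨b, hb, rfl⟩)
    · refine ⟨Or.inl subset_rfl, ?_⟩
      rintro Y (h | ⟨b, hb, h⟩) hY
      · exact h
      · exact absurd (hY (h (by simp : a ∈ ({a, b} : Finset α)))) (by simp)
    · refine ⟨Or.inr ⟨b, hb, subset_rfl⟩, ?_⟩
      rintro Y (h | ⟨c, hc, h⟩) hY
      · exfalso
        have : M.ground.erase a ⊆ {b} := fun x hx => by
          have := hY (h hx)
          simp only [Finset.mem_insert, Finset.mem_singleton] at this
          exact Finset.mem_singleton.mpr (this.resolve_left (Finset.mem_erase.mp hx).1)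
        have := Finset.card_le_card this
        rw [Finset.card_erase_of_mem ha, Finset.card_singleton] at this
        omega
      · have hcb : c = b := by
          have := hY (h (by simp : c ∈ ({a, c} : Finset α)))
          simp only [Finset.mem_insert, Finset.mem_singleton] at this
          exact this.resolve_left (Finset.mem_erase.mp hc).1
        exact hcb ▸ h

theorem isExtendedOddHole_blocker {α : Type*} [DecidableEq α] {M : Clutter α} {n : ℕ}
    (h5 : 5 ≤ n) (hn : Odd n) {a : ZMod n → α} (ha : Function.Injective a)
    (hW : ∀ x, x ∈ M.ground ↔ ∃ i, a i = x) (hcard : ∀ T, M.IsCover T → 2 ≤ T.card)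
    (hpair : ∀ T ⊆ M.ground, T.card = 2 → (M.IsCover T ↔ ∃ i, T = {a i, a (i + 1)})) :
    M.blocker.IsExtendedOddHole := by
  have : Fact (1 < n) := ⟨by omega⟩
  have hne : ∀ i, a i ≠ a (i + 1) := fun i h => by simpa using ha h
  have hsub : ∀ i, {a i, a (i + 1)} ⊆ M.ground := by
    intro i y hy
    simp only [Finset.mem_insert, Finset.mem_singleton] at hy
    rcases hy with rfl | rfl <;> exact (hW _).mpr ⟨_, rfl⟩
  have hmem : ∀ i, {a i, a (i + 1)} ∈ M.blocker.members := by
    intro i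
    refine ⟨(hpair _ (hsub i) (Finset.card_pair (hne i))).mpr ⟨i, rfl⟩, fun Y hY hle => ?_⟩
    refine (Finset.eq_of_subset_of_card_le hle ?_).ge
    rw [Finset.card_pair (hne i)]
    exact hcard Y hY
  refine ⟨n, h5, hn, a, ha, hW, Set.ext fun X => ?_⟩
  simp only [Set.mem_ofPred_eq]
  constructor
  · rintro ⟨hX, hmin⟩
    have h2 := hmin _ (hmem 0)
    rw [Finset.card_pair (hne 0)] at h2
    have hXc : M.IsCover X := hX.prop
    exact (hpair X hXc.1 (le_antisymm h2 (hcard X hXc))).mp hXc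
  · rintro ⟨i, rfl⟩
    refine ⟨hmem i, fun B hB => ?_⟩
    rw [Finset.card_pair (hne i)]
    exact hcard B (Minimal.prop hB)

theorem hasMinor_of_obstructed {α : Type*} [DecidableEq α] [Fintype α] {C : Clutter α}
    (hC : C.ground = Finset.univ)
    (h : Obstructed fun T => ∀ A ∈ C.members, (A ∩ T).Nonempty) :
    C.HasMinor fun D => D.IsDelta ∨ D.IsBlockerOfExtendedOddHole := by
  obtain ⟨I, W, h⟩ := h
  have hdisj : Disjoint I W := h.elim DeltaOn.disjoint OddHoleOn.disjoint
  have hg : (C.minor I (Finset.univ \ (I ∪ W))).ground = W := by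
    ext x
    have : x ∈ I → x ∉ W := fun hx => Finset.disjoint_left.mp hdisj hx
    simp only [minor, hC, Finset.mem_sdiff, Finset.mem_univ, Finset.mem_union, true_and]
    tauto
  have hcov : ∀ T ⊆ W, (C.minor I (Finset.univ \ (I ∪ W))).IsCover T ↔
      ∀ A ∈ C.members, (A ∩ (I ∪ T)).Nonempty := fun T hT =>
    C.minor_isCover_iff I _ T (by rw [← hg] at hT; exact hT)
  refine ⟨I, Finset.univ \ (I ∪ W), by simp [hC], by simp [hC], ?_, ?_⟩
  · rw [Finset.disjoint_left]
    intro x hx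
    simp [hx]
  generalize C.minor I (Finset.univ \ (I ∪ W)) = M at hg hcov
  subst hg
  rcases h with ⟨h3, a, ha, hP⟩ | ⟨n, h5, hn, a, ha, hW, hcard, hP⟩
  · exact Or.inl (isDelta_of_isCover_iff h3 ha fun T hT => (hcov T hT).trans (hP T hT))
  · refine Or.inr ⟨M.blocker, isExtendedOddHole_blocker h5 hn ha hW ?_ ?_, M.blocker_blocker.symm⟩
    · exact fun T hT => hcard T hT.1 ((hcov T hT.1).mp hT)
    · exact fun T hT h2 => (hcov T hT).trans (hP T hT h2)

end Clutter

/-! ### Finding obstructions: cherries, odd cycles, monochromatic sets -/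

/-- Contract a maximal `Y ⊆ B` for which `u` alone does not suffice afterwards. By maximality `u`
now pairs with every remaining element of `B`, and the rest of `B` is still minimal: a delta with
centre `u`. The partners `v` and `w` cannot lie in `Y`, so at least three elements remain. -/
theorem obstructed_of_cherry {α : Type*} [DecidableEq α] [Finite α] {P : Finset α → Prop}
    (hP : Monotone P) {I B : Finset α} {u v w : α} (hu : u ∉ B) (hv : v ∈ B) (hw : w ∈ B)
    (hvw : v ≠ w) (huv : P (I ∪ {u, v})) (huw : P (I ∪ {u, w})) (hB : P (I ∪ B))
    (hmin : ∀ b ∈ B, ¬ P (I ∪ B.erase b)) (hsu : ¬ P (insert u I)) : Obstructed P := by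
  obtain ⟨Y, -, ⟨hYB, hYP⟩, hYmax⟩ := exists_maximal_ge_of_wellFoundedGT
    (fun Y => Y ⊆ B ∧ ¬ P (insert u (I ∪ Y))) ∅ ⟨by simp, by simpa using hsu⟩
  have hnot : ∀ b, P (I ∪ {u, b}) → b ∉ Y := fun b hb hbY => by
    refine hYP (hP ?_ hb)
    intro x hx
    simp only [Finset.mem_union, Finset.mem_insert, Finset.mem_singleton] at hx ⊢
    rcases hx with hx | rfl | rfl <;> simp_all
  refine ⟨I ∪ Y, insert u (B \ Y), Or.inl ⟨?_, u, by simp, ?_⟩⟩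
  · rw [Finset.card_insert_of_notMem (by simp [hu])]
    have h : ({v, w} : Finset α) ⊆ B \ Y := by
      intro x hx
      simp only [Finset.mem_insert, Finset.mem_singleton] at hx
      rcases hx with rfl | rfl
      · simp [hv, hnot _ huv]
      · simp [hw, hnot _ huw]
    have := Finset.card_le_card h
    rw [Finset.card_pair hvw] at this
    omega
  · rw [Finset.erase_insert (by simp [hu])]
    intro T hT
    constructor
    · intro hPT
      by_cases huT : u ∈ T
      · right
        by_contra! hno
        have hTu : T ⊆ {u} := fun x hx => by
          rcases Finset.mem_insert.mp (hT hx) with rfl | hxB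
          · simp
          · exact absurd (by simp [Finset.insert_subset_iff, huT, hx]) (hno x hxB)
        refine hYP (hP ?_ hPT)
        intro x hx
        rcases Finset.mem_union.mp hx with hx | hx
        · exact Finset.mem_insert_of_mem hx
        · simp [Finset.mem_singleton.mp (hTu hx)]
      · left
        intro b hb
        by_contra hbT
        refine hmin b (Finset.mem_sdiff.mp hb).1 (hP ?_ hPT)
        intro x hx
        simp only [Finset.mem_union, Finset.mem_erase] at hx ⊢
        rcases hx with (hx | hx) | hx
        · exact Or.inl hx
        · exact Or.inr ⟨fun h => (Finset.mem_sdiff.mp hb).2 (h ▸ hx), hYB hx⟩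
        · refine Or.inr ⟨fun h => hbT (h ▸ hx), ?_⟩
          rcases Finset.mem_insert.mp (hT hx) with rfl | hxB
          · exact absurd hx huT
          · exact (Finset.mem_sdiff.mp hxB).1
    · rintro (h | ⟨b, hb, h⟩)
      · refine hP ?_ hB
        intro x hx
        by_cases hxY : x ∈ Y
        · simp [hxY]
        rcases Finset.mem_union.mp hx with hx | hx
        · simp [hx]
        · exact Finset.mem_union_right _ (h (by simp [hx, hxY]))
      · have hbP : P (I ∪ Y ∪ {u, b}) := by
          by_contra hn
          have hle : insert b Y ≤ Y := hYmax
            ⟨by simp [Finset.insert_subset_iff, (Finset.mem_sdiff.mp hb).1, hYB], fun h' =>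
              hn (hP (by intro x hx; simp at hx ⊢; tauto) h')⟩ (Finset.subset_insert b Y)
          exact (Finset.mem_sdiff.mp hb).2 (hle (Finset.mem_insert_self b Y))
        exact hP (Finset.union_subset_union_right h) hbP

/-- The graph on `W` of the two-element sets in the contraction of `P` by `I`. -/
def pairGraph {α : Type*} [DecidableEq α] (P : Finset α → Prop) (I W : Finset α) :
    SimpleGraph α where
  Adj x y := x ≠ y ∧ x ∈ W ∧ y ∈ W ∧ P (I ∪ {x, y})
  symm := ⟨fun x y h => ⟨h.1.symm, h.2.2.1, h.2.1, by rw [Finset.pair_comm]; exact h.2.2.2⟩⟩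
  loopless := ⟨fun _ h => h.1 rfl⟩

theorem SimpleGraph.Walk.exists_segment {α : Type*} {G : SimpleGraph α} {x y : α} (w : G.Walk x y)
    (i m : ℕ) (h : i + m ≤ w.length) :
    ∃ p : G.Walk (w.getVert i) (w.getVert (i + m)), p.length = m := by
  induction m with
  | zero => exact ⟨Walk.nil, rfl⟩
  | succ m ih =>
    obtain ⟨p, hp⟩ := ih (by omega)
    exact ⟨p.concat (w.adj_getVert_succ (by omega)), by simp [hp]⟩

/-- A shortest closed walk of odd length has no repeated vertices and no chords. -/
theorem SimpleGraph.exists_induced_odd_cycle {α : Type*} {G : SimpleGraph α} {x : α}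
    (w : G.Walk x x) (hw : Odd w.length) :
    ∃ n, 3 ≤ n ∧ Odd n ∧ ∃ f : ℕ → α, f n = f 0 ∧ (∀ i < n, G.Adj (f i) (f (i + 1))) ∧
      (∀ i j, i < j → j < n → f i ≠ f j) ∧
      ∀ i j, i < j → j < n → G.Adj (f i) (f j) → j = i + 1 ∨ (i = 0 ∧ j + 1 = n) := by
  classical
  have hex : ∃ n, Odd n ∧ ∃ x, ∃ w : G.Walk x x, w.length = n := ⟨_, hw, x, w, rfl⟩
  obtain ⟨hn, x, w, hwn⟩ := Nat.find_spec hex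
  have hshort : ∀ {y} (p : G.Walk y y), Odd p.length → Nat.find hex ≤ p.length :=
    fun p hp => Nat.find_min' hex ⟨hp, _, p, rfl⟩
  generalize Nat.find hex = n at hn hwn hshort
  have hadj : ∀ i < n, G.Adj (w.getVert i) (w.getVert (i + 1)) :=
    fun i hi => w.adj_getVert_succ (by omega)
  have h0 : w.getVert n = w.getVert 0 := by rw [← hwn]; simp
  have hback : ∀ i j, i < j → j < n →
      ∃ p : G.Walk (w.getVert j) (w.getVert i), p.length = n - (j - i) := by
    intro i j hij hj
    obtain ⟨p, hp⟩ := w.exists_segment j (n - j) (by omega)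
    obtain ⟨q, hq⟩ := w.exists_segment 0 i (by omega)
    have e1 : w.getVert (j + (n - j)) = w.getVert 0 := by rw [← h0]; congr 1; omega
    have e2 : w.getVert (0 + i) = w.getVert i := by rw [zero_add]
    exact ⟨(p.copy rfl e1).append (q.copy rfl e2), by simp [hp, hq]; omega⟩
  have hforth : ∀ i j, i < j → j < n →
      ∃ p : G.Walk (w.getVert i) (w.getVert j), p.length = j - i := by
    intro i j hij hj
    obtain ⟨p, hp⟩ := w.exists_segment i (j - i) (by omega)
    have e : w.getVert (i + (j - i)) = w.getVert j := by congr 1; omega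
    exact ⟨p.copy rfl e, by simpa using hp⟩
  refine ⟨n, ?_, hn, w.getVert, h0, hadj, ?_, ?_⟩
  · by_contra h3
    have h1 : n = 1 := by
      obtain ⟨k, rfl⟩ := hn
      omega
    subst h1
    have := hadj 0 (by omega)
    rw [zero_add, h0] at this
    exact G.loopless.irrefl _ this
  · intro i j hij hj heq
    obtain ⟨p, hp⟩ := hforth i j hij hj
    obtain ⟨q, hq⟩ := hback i j hij hj
    -- Both arcs between the equal vertices are closed walks; their lengths sum to the odd `n`, so
    -- one is odd, and it is shorter.
    rcases Nat.even_or_odd (j - i) with hpar | hpar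
    · have h1 := hshort (q.copy rfl heq) (by
        rw [Walk.length_copy, hq, Nat.odd_sub (by omega)]
        simp [hn, hpar])
      rw [Walk.length_copy] at h1
      omega
    · have h1 := hshort (p.copy heq rfl) (by rwa [Walk.length_copy, hp])
      rw [Walk.length_copy] at h1
      omega
  · intro i j hij hj hA
    obtain ⟨p, hp⟩ := hforth i j hij hj
    obtain ⟨q, hq⟩ := hback i j hij hj
    -- The chord closes the arc of even length to an odd walk. Its length is at least `n` only if
    -- the other arc is a single edge.
    rcases Nat.even_or_odd (j - i) with hpar | hpar
    · have h1 := hshort (p.cons hA.symm) (by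
        rw [Walk.length_cons, hp]
        exact hpar.add_one)
      rw [Walk.length_cons] at h1
      omega
    · have h1 := hshort (q.cons hA) (by
        rw [Walk.length_cons, hq]
        exact (Nat.Odd.sub_odd hn hpar).add_one)
      rw [Walk.length_cons] at h1
      omega

/-- An induced odd cycle of length at least five is all that an extended odd hole requires, its
larger members being arbitrary. A triangle is a cherry whose set `B` is the opposite edge. -/
theorem obstructed_of_odd_closed_walk {α : Type*} [DecidableEq α] [Finite α]
    {P : Finset α → Prop} (hP : Monotone P) {I W : Finset α} (hs : ∀ y ∈ W, ¬ P (insert y I))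
    {x : α} (w : (pairGraph P I W).Walk x x) (hw : Odd w.length) : Obstructed P := by
  obtain ⟨n, h3, hn, f, h0, hadj, hinj, hchord⟩ := SimpleGraph.exists_induced_odd_cycle w hw
  by_cases hn3 : n = 3
  · subst hn3
    have h01 := hadj 0 (by omega)
    have h12 := hadj 1 (by omega)
    have h20 := hadj 2 (by omega)
    rw [show 2 + 1 = 3 from rfl, h0] at h20
    have hne : f 1 ≠ f 2 := h12.1
    refine obstructed_of_cherry hP (I := I) (B := {f 1, f 2}) (u := f 0) (v := f 1) (w := f 2)
      ?_ (by simp) (by simp) h12.1 h01.2.2.2 h20.symm.2.2.2 h12.2.2.2 ?_ (hs _ h01.2.1)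
    · simpa using ⟨h01.1, h20.1.symm⟩
    · intro b hb hbP
      simp only [Finset.mem_insert, Finset.mem_singleton] at hb
      rcases hb with rfl | rfl
      · refine hs _ h12.2.2.1 (hP ?_ hbP)
        intro y hy; simp at hy ⊢; tauto
      · refine hs _ h12.2.1 (hP ?_ hbP)
        intro y hy; simp at hy ⊢; tauto
  · have h5 : 5 ≤ n := by
      obtain ⟨k, rfl⟩ := hn
      omega
    have : NeZero n := ⟨by omega⟩
    have : Fact (1 < n) := ⟨by omega⟩
    set a : ZMod n → α := fun i => f i.val with ha
    have hval : ∀ i : ZMod n, f (i + 1).val = f (i.val + 1) := by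
      intro i
      rw [ZMod.val_add, ZMod.val_one]
      rcases Nat.lt_or_ge (i.val + 1) n with h | h
      · rw [Nat.mod_eq_of_lt h]
      · have : i.val + 1 = n := le_antisymm (ZMod.val_lt i) h
        rw [this, Nat.mod_self, h0]
    have hcast : ∀ k, k < n → a (k : ZMod n) = f k := fun k hk => by
      simp only [ha, ZMod.val_cast_of_lt hk]
    have haadj : ∀ i, (pairGraph P I W).Adj (a i) (a (i + 1)) := by
      intro i
      have := hadj i.val (ZMod.val_lt i)
      simpa only [ha, hval] using this
    have hainj : Function.Injective a := by
      intro i j hij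
      rcases lt_trichotomy i.val j.val with h | h | h
      · exact absurd hij (hinj _ _ h (ZMod.val_lt j))
      · exact ZMod.val_injective n h
      · exact absurd hij.symm (hinj _ _ h (ZMod.val_lt i))
    have hachord : ∀ i j : ZMod n, i.val < j.val → (pairGraph P I W).Adj (a i) (a j) →
        ∃ k, ({a i, a j} : Finset α) = {a k, a (k + 1)} := by
      intro i j hij hA
      rcases hchord _ _ hij (ZMod.val_lt j) hA with h | ⟨h, h'⟩
      · exact ⟨i, by simp only [ha, hval, h]⟩
      · refine ⟨j, ?_⟩
        rw [Finset.pair_comm]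
        simp only [ha, hval, h, h', h0]
    refine ⟨I, Finset.univ.image a, Or.inr ⟨n, h5, hn, a, hainj, by simp, ?_, ?_⟩⟩
    · intro T hT hPT
      by_contra hcard
      obtain ⟨y, hy, hTy⟩ : ∃ y ∈ W, T ⊆ {y} := by
        rcases T.eq_empty_or_nonempty with rfl | ⟨y, hy⟩
        · exact ⟨a 0, (haadj 0).2.1, by simp⟩
        · obtain ⟨i, -, rfl⟩ := Finset.mem_image.mp (hT hy)
          exact ⟨a i, (haadj i).2.1, fun z hz =>
            Finset.mem_singleton.mpr (Finset.card_le_one.mp (by omega) z hz _ hy)⟩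
      refine hs y hy (hP ?_ hPT)
      intro z hz
      rcases Finset.mem_union.mp hz with hz | hz
      · simp [hz]
      · simp [Finset.mem_singleton.mp (hTy hz)]
    · intro T hT h2
      constructor
      · intro hPT
        obtain ⟨y, z, hyz, rfl⟩ := Finset.card_eq_two.mp h2
        obtain ⟨i, -, rfl⟩ := Finset.mem_image.mp (hT (Finset.mem_insert_self _ _))
        obtain ⟨j, -, rfl⟩ := Finset.mem_image.mp (hT (show z ∈ ({a i, z} : Finset α) by simp))
        have hA : (pairGraph P I W).Adj (a i) (a j) :=
          ⟨hyz, (haadj i).2.1, (haadj j).2.1, hPT⟩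
        rcases lt_trichotomy i.val j.val with h | h | h
        · exact hachord i j h hA
        · exact absurd (congrArg a (ZMod.val_injective n h)) hyz
        · rw [Finset.pair_comm]
          exact hachord j i h hA.symm
      · rintro ⟨i, rfl⟩
        exact (haadj i).2.2.2

/-- The subgraph of `pairGraph` of the pairs that are not monochromatic. -/
def colorGraph {α : Type*} [DecidableEq α] (P : Finset α → Prop) (I W : Finset α) (c : α → Bool) :
    SimpleGraph α where
  Adj x y := c x ≠ c y ∧ x ∈ W ∧ y ∈ W ∧ P (I ∪ {x, y})
  symm := ⟨fun x y h => ⟨h.1.symm, h.2.2.1, h.2.1, by rw [Finset.pair_comm]; exact h.2.2.2⟩⟩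
  loopless := ⟨fun _ h => h.1 rfl⟩

theorem colorGraph_le_pairGraph {α : Type*} [DecidableEq α] (P : Finset α → Prop)
    (I W : Finset α) (c : α → Bool) : colorGraph P I W c ≤ pairGraph P I W :=
  fun _ _ h => ⟨fun e => h.1 (congrArg c e), h.2⟩

theorem SimpleGraph.Reachable.mem_of_closed {α : Type*} {G : SimpleGraph α} {s : Set α} {x y : α}
    (h : G.Reachable x y) (hs : ∀ x ∈ s, ∀ y, G.Adj x y → y ∈ s) (hx : x ∈ s) : y ∈ s := by
  obtain ⟨w⟩ := h
  induction w with
  | nil => exact hx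
  | cons hadj _ ih => exact ih (hs _ hx _ hadj)

/-- A walk changing colour at each step between ends of equal colour is even, so the additional pair
closes it to an odd walk. -/
theorem obstructed_of_monochromatic_pair {α : Type*} [DecidableEq α] [Finite α]
    {P : Finset α → Prop} (hP : Monotone P) {I W : Finset α} {c : α → Bool}
    (hs : ∀ y ∈ W, ¬ P (insert y I)) {x y : α} (hxy : x ≠ y) (hx : x ∈ W) (hy : y ∈ W)
    (hc : c x = c y) (hr : (colorGraph P I W c).Reachable x y) (hPxy : P (I ∪ {x, y})) :
    Obstructed P := by
  obtain ⟨p⟩ := hr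
  let C : (colorGraph P I W c).Coloring Bool := SimpleGraph.Coloring.mk c fun h => h.1
  have heven : Even p.length := by
    rw [C.even_length_iff_congr p]
    change c x = true ↔ c y = true
    rw [hc]
  have hA : (pairGraph P I W).Adj y x :=
    ⟨hxy.symm, hy, hx, by rw [Finset.pair_comm]; exact hPxy⟩
  refine obstructed_of_odd_closed_walk hP hs
    ((p.mapLe (colorGraph_le_pairGraph P I W c)).cons hA) ?_
  rw [SimpleGraph.Walk.length_cons, SimpleGraph.Walk.length_map]
  exact heven.add_one

/-- If `W` is connected by non-monochromatic pairs and contains a monochromatic set of the family,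
then the family is obstructed. -/
theorem obstructed_of_monochromatic {α : Type*} [DecidableEq α] [Fintype α]
    {P : Finset α → Prop} (hP : Monotone P) (c : α → Bool) (N : ℕ) :
    ∀ I W B : Finset α, W.card ≤ N → (∀ y ∈ W, ¬ P (insert y I)) →
      (∀ x ∈ W, ∀ y ∈ W, (colorGraph P I W c).Reachable x y) → B ⊆ W → B.Nonempty →
      (∀ x ∈ B, ∀ y ∈ B, c x = c y) → P (I ∪ B) → Obstructed P := by
  classical
  induction N with
  | zero =>
    intro I W B hW _ _ hBW hB _ _
    obtain ⟨b, hb⟩ := hB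
    have := Finset.card_pos.mpr ⟨b, hBW hb⟩
    omega
  | succ N ih =>
    intro I W B₀ hWN hs hconn hB₀W hB₀ hcol₀ hPB₀
    obtain ⟨B, hBB₀, hPB, hBmin⟩ :=
      exists_minimal_le_of_wellFoundedLT (fun B => P (I ∪ B)) B₀ hPB₀
    have hBW : B ⊆ W := hBB₀.trans hB₀W
    have hcol : ∀ x ∈ B, ∀ y ∈ B, c x = c y := fun x hx y hy => hcol₀ x (hBB₀ hx) y (hBB₀ hy)
    have hmin : ∀ b ∈ B, ¬ P (I ∪ B.erase b) := fun b hb h =>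
      Finset.notMem_erase b B (hBmin h (Finset.erase_subset b B) hb)
    obtain ⟨b₁, hb₁, b₂, hb₂, hb₁₂⟩ : ∃ b₁ ∈ B, ∃ b₂ ∈ B, b₁ ≠ b₂ := by
      by_contra! h
      obtain ⟨b₀, hb₀⟩ := hB₀
      rcases B.eq_empty_or_nonempty with rfl | ⟨b, hb⟩
      · exact hs b₀ (hB₀W hb₀) (hP (by simp) hPB)
      · refine hs b (hBW hb) (hP ?_ hPB)
        intro x hx
        rcases Finset.mem_union.mp hx with hx | hx
        · simp [hx]
        · simp [h x hx b hb]
    by_cases hcut : ∃ w ∈ W, w ∉ B ∧ ∀ x ∈ W.erase w, ∀ y ∈ W.erase w,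
        (colorGraph P I (W.erase w) c).Reachable x y
    · obtain ⟨w, hw, hwB, hw'⟩ := hcut
      refine ih I (W.erase w) B ?_ (fun y hy => hs y (Finset.mem_of_mem_erase hy)) hw'
        (Finset.subset_erase.mpr ⟨hBW, hwB⟩) ⟨b₁, hb₁⟩ hcol hPB
      rw [Finset.card_erase_of_mem hw]
      omega
    push Not at hcut
    -- Now every vertex outside `B` is a cut vertex. Choose such a `v` and a component of `W - v`
    -- with as many vertices as possible.
    let K : α → α → Finset α := fun v x =>
      (W.erase v).filter fun y => (colorGraph P I (W.erase v) c).Reachable x y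
    have hnbr : ∀ x ∈ W, ∀ y ∈ W, x ≠ y → ∃ z, (colorGraph P I W c).Adj x z := by
      intro x hx y hy hxy
      by_contra! h
      have := (hconn x hx y hy).mem_of_closed (s := {x}) (by
        rintro _ rfl z hz
        exact absurd hz (h z)) rfl
      exact hxy this.symm
    obtain ⟨v₀, hv₀⟩ := hnbr b₁ (hBW hb₁) b₂ (hBW hb₂) hb₁₂
    have hv₀B : v₀ ∉ B := fun h => hv₀.1 (hcol _ hb₁ _ h)
    have hne : b₁ ∈ W.erase v₀ :=
      Finset.mem_erase.mpr ⟨fun h => hv₀B (h ▸ hb₁), hBW hb₁⟩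
    obtain ⟨⟨v, x⟩, hvx, hmax⟩ := Finset.exists_max_image
      ((Finset.univ : Finset (α × α)).filter fun q => q.1 ∈ W ∧ q.1 ∉ B ∧ q.2 ∈ W.erase q.1)
      (fun q => (K q.1 q.2).card) ⟨(v₀, b₁), by
        simp only [Finset.mem_filter, Finset.mem_univ, true_and]
        exact ⟨hv₀.2.2.1, hv₀B, hne⟩⟩
    simp only [Finset.mem_filter, Finset.mem_univ, true_and] at hvx hmax
    obtain ⟨hvW, hvB, hxW⟩ := hvx
    have hmemK : ∀ y, y ∈ K v x ↔
        y ∈ W.erase v ∧ (colorGraph P I (W.erase v) c).Reachable x y := fun y => by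
      simp [K]
    have hxK : x ∈ K v x := (hmemK x).mpr ⟨hxW, SimpleGraph.Reachable.refl x⟩
    have hclosed : ∀ z ∈ K v x, ∀ z', (colorGraph P I W c).Adj z z' → z' ≠ v → z' ∈ K v x := by
      intro z hz z' hA hz'
      have h := (hmemK z).mp hz
      have hz'W : z' ∈ W.erase v := Finset.mem_erase.mpr ⟨hz', hA.2.2.1⟩
      have hA' : (colorGraph P I (W.erase v) c).Adj z z' := ⟨hA.1, h.1, hz'W, hA.2.2.2⟩
      exact (hmemK z').mpr ⟨hz'W, h.2.trans hA'.reachable⟩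
    obtain ⟨z, hzK, hzv⟩ : ∃ z ∈ K v x, (colorGraph P I W c).Adj z v := by
      by_contra! h
      have := (hconn x (Finset.mem_of_mem_erase hxW) v hvW).mem_of_closed
        (s := {z | z ∈ K v x}) (fun z hz z' hA => hclosed z hz z' hA fun e => h z hz (e ▸ hA)) hxK
      exact Finset.notMem_erase v W ((hmemK v).mp this).1
    have hreachK : ∀ (G : SimpleGraph α), (∀ k ∈ K v x, ∀ k' ∈ K v x,
        (colorGraph P I (W.erase v) c).Adj k k' → G.Adj k k') → ∀ k ∈ K v x, G.Reachable x k := by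
      intro G hG k hk
      have := ((hmemK k).mp hk).2.mem_of_closed (s := {k | k ∈ K v x ∧ G.Reachable x k}) (by
        rintro k ⟨hk, hr⟩ k' hA
        have hk' : k' ∈ K v x := (hmemK k').mpr ⟨hA.2.2.1, ((hmemK k).mp hk).2.trans hA.reachable⟩
        exact ⟨hk', hr.trans (hG k hk k' hk' hA).reachable⟩) ⟨hxK, SimpleGraph.Reachable.refl x⟩
      exact this.2
    -- Otherwise `y` could replace `v`: removing `y` leaves the component and `v` connected,
    -- contradicting the maximal size.
    have hout : ∀ y ∈ W.erase v, y ∉ K v x → y ∈ B := by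
      intro y hyW hyK
      by_contra hyB
      have hyv := (Finset.mem_erase.mp hyW).1
      have hyW' := (Finset.mem_erase.mp hyW).2
      have hKy : ∀ k ∈ K v x, k ∈ W.erase y := fun k hk =>
        Finset.mem_erase.mpr ⟨fun e => hyK (e ▸ hk),
          Finset.mem_of_mem_erase ((hmemK k).mp hk).1⟩
      have hvy : v ∈ W.erase y := Finset.mem_erase.mpr ⟨hyv.symm, hvW⟩
      have hr := hreachK (colorGraph P I (W.erase y) c) fun k hk k' hk' hA =>
        ⟨hA.1, hKy k hk, hKy k' hk', hA.2.2.2⟩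
      have hrv : (colorGraph P I (W.erase y) c).Reachable x v :=
        (hr z hzK).trans (SimpleGraph.Adj.reachable ⟨hzv.1, hKy z hzK, hvy, hzv.2.2.2⟩)
      have hsub : insert v (K v x) ⊆ K y x := by
        intro k hk
        rcases Finset.mem_insert.mp hk with rfl | hk
        · simp only [K, Finset.mem_filter]
          exact ⟨hvy, hrv⟩
        · simp only [K, Finset.mem_filter]
          exact ⟨hKy k hk, hr k hk⟩
      have h1 := Finset.card_le_card hsub
      rw [Finset.card_insert_of_notMem fun h => Finset.notMem_erase v W ((hmemK v).mp h).1] at h1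
      have h2 := hmax (y, x) ⟨hyW', hyB, hKy x hxK⟩
      simp only at h2
      omega
    -- The vertices outside the component lie in `B`, so they have one colour and no edges among
    -- themselves; only `v` is left as a neighbour.
    have hleaf : ∀ y ∈ W.erase v, y ∉ K v x →
        ∀ z, (colorGraph P I W c).Adj y z → z = v := by
      intro y hyW hyK z hA
      by_contra hzv
      have hzW : z ∈ W.erase v := Finset.mem_erase.mpr ⟨hzv, hA.2.2.1⟩
      by_cases hzK : z ∈ K v x
      · exact hyK (hclosed z hzK y hA.symm (Finset.mem_erase.mp hyW).1)
      · exact hA.1 (hcol y (hout y hyW hyK) z (hout z hzW hzK))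
    have hleafv : ∀ y ∈ W.erase v, y ∉ K v x → (colorGraph P I W c).Adj v y := by
      intro y hyW hyK
      obtain ⟨z, hz⟩ := hnbr y (Finset.mem_of_mem_erase hyW) v hvW (Finset.mem_erase.mp hyW).1
      have := hleaf y hyW hyK z hz
      exact this ▸ hz.symm
    obtain ⟨y, hyW, hyK⟩ : ∃ y ∈ W.erase v, y ∉ K v x := by
      by_contra! h
      obtain ⟨p, hp, q, hq, hpq⟩ := hcut v hvW hvB
      exact hpq (((hmemK p).mp (h p hp)).2.symm.trans ((hmemK q).mp (h q hq)).2)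
    have hyv := (Finset.mem_erase.mp hyW).1
    have hyW' := (Finset.mem_erase.mp hyW).2
    have hyB := hout y hyW hyK
    -- Two leaves at `v` form a cherry with the minimal set `B`. With a single leaf `y`, contract
    -- `y` and recurse on the component, unless some `k` pairs with `y`; such a `k` must have the
    -- colour of `y`.
    by_cases htwo : ∃ y' ∈ W.erase v, y' ∉ K v x ∧ y' ≠ y
    · obtain ⟨y', hy'W, hy'K, hyy'⟩ := htwo
      exact obstructed_of_cherry hP hvB hyB (hout y' hy'W hy'K) hyy'.symm
        (hleafv y hyW hyK).2.2.2 (hleafv y' hy'W hy'K).2.2.2 hPB hmin (hs v hvW)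
    push Not at htwo
    by_cases hsing : ∃ k ∈ K v x, P (insert k (insert y I))
    · obtain ⟨k, hk, hPk⟩ := hsing
      have hkW := ((hmemK k).mp hk).1
      have hkW' := Finset.mem_of_mem_erase hkW
      have hky : y ≠ k := fun e => hyK (e ▸ hk)
      have hPk' : P (I ∪ {y, k}) := hP (by intro x hx; simp at hx ⊢; tauto) hPk
      refine obstructed_of_monochromatic_pair hP hs hky hyW' hkW' ?_ (hconn y hyW' k hkW') hPk'
      by_contra hcyk
      exact (Finset.mem_erase.mp hkW).1 (hleaf y hyW hyK k ⟨hcyk, hyW', hkW', hPk'⟩)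
    push Not at hsing
    have hr := hreachK (colorGraph P (insert y I) (K v x) c) fun k hk k' hk' hA =>
      ⟨hA.1, hk, hk', hP (Finset.union_subset_union_left (Finset.subset_insert y I)) hA.2.2.2⟩
    refine ih (insert y I) (K v x) (B.erase y) ?_ hsing
      (fun k hk k' hk' => (hr k hk).symm.trans (hr k' hk')) ?_ ?_
      (fun p hp q hq => hcol p (Finset.mem_of_mem_erase hp) q (Finset.mem_of_mem_erase hq))
      (hP ?_ hPB)
    · have h1 : K v x ⊆ W.erase v := Finset.filter_subset _ _
      have h2 := Finset.card_le_card h1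
      rw [Finset.card_erase_of_mem hvW] at h2
      omega
    · intro b hb
      obtain ⟨hby, hbB⟩ := Finset.mem_erase.mp hb
      by_contra hbK
      exact hby (htwo b (Finset.mem_erase.mpr ⟨fun e => hvB (e ▸ hbB), hBW hbB⟩) hbK)
    · by_cases h : b₁ = y
      · exact ⟨b₂, Finset.mem_erase.mpr ⟨fun e => hb₁₂ (h.trans e.symm), hb₂⟩⟩
      · exact ⟨b₁, Finset.mem_erase.mpr ⟨h, hb₁⟩⟩
    · intro p hp
      simp only [Finset.mem_union, Finset.mem_insert, Finset.mem_erase] at hp ⊢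
      tauto

/-! ### Literals and balanced distributions -/

/-- The nontrivial real character of `ZMod 2`. -/
noncomputable def chi (a : ZMod 2) : ℝ := if a = 0 then 1 else -1

theorem zmod_two_eq_zero_or_one (a : ZMod 2) : a = 0 ∨ a = 1 := by
  revert a; decide

@[simp] theorem chi_zero : chi 0 = 1 := by simp [chi]

@[simp] theorem chi_one : chi 1 = -1 := by simp [chi]

theorem chi_add (a b : ZMod 2) : chi (a + b) = chi a * chi b := by
  have h : (1 + 1 : ZMod 2) = 0 := by decide
  rcases zmod_two_eq_zero_or_one a with rfl | rfl <;>
    rcases zmod_two_eq_zero_or_one b with rfl | rfl <;> simp [h]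

theorem chi_mul_self (a : ZMod 2) : chi a * chi a = 1 := by
  rcases zmod_two_eq_zero_or_one a with rfl | rfl <;> simp

/-- The sets of literals that cover the cuboid of `S`. -/
def Hits {n : ℕ} (S : Set (Fin n → ZMod 2)) (T : Finset (Fin n × Bool)) : Prop :=
  ∀ p ∈ S, ∃ e ∈ T, e ∈ cuboidMember p

theorem hits_monotone {n : ℕ} (S : Set (Fin n → ZMod 2)) : Monotone (Hits S) := by
  intro T T' hT h p hp
  obtain ⟨e, he, hep⟩ := h p hp
  exact ⟨e, hT he, hep⟩

theorem true_mem_cuboidMember {n : ℕ} {p : Fin n → ZMod 2} {j : Fin n} :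
    (j, true) ∈ cuboidMember p ↔ p j = 1 := by
  simp [cuboidMember]

theorem false_mem_cuboidMember {n : ℕ} {p : Fin n → ZMod 2} {j : Fin n} :
    (j, false) ∈ cuboidMember p ↔ p j = 0 := by
  simp [cuboidMember]

theorem mem_cuboidMember_or {n : ℕ} (p : Fin n → ZMod 2) (j : Fin n) :
    (j, true) ∈ cuboidMember p ∨ (j, false) ∈ cuboidMember p := by
  rw [true_mem_cuboidMember, false_mem_cuboidMember]
  exact (zmod_two_eq_zero_or_one _).symm

/-- The points of `S` that satisfy none of the literals in `U`. -/
def avoiding {n : ℕ} (S : Set (Fin n → ZMod 2)) (U : Finset (Fin n × Bool)) :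
    Set (Fin n → ZMod 2) :=
  {p | p ∈ S ∧ ∀ e ∈ U, e ∉ cuboidMember p}

theorem hits_avoiding {n : ℕ} (S : Set (Fin n → ZMod 2)) (U T : Finset (Fin n × Bool)) :
    Hits (avoiding S U) T ↔ Hits S (U ∪ T) := by
  constructor
  · intro h p hp
    by_cases hU : ∃ e ∈ U, e ∈ cuboidMember p
    · obtain ⟨e, he, hep⟩ := hU
      exact ⟨e, Finset.mem_union_left _ he, hep⟩
    · push Not at hU
      obtain ⟨e, he, hep⟩ := h p ⟨hp, hU⟩
      exact ⟨e, Finset.mem_union_right _ he, hep⟩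
  · rintro h p ⟨hp, hU⟩
    obtain ⟨e, he, hep⟩ := h p hp
    exact ⟨e, (Finset.mem_union.mp he).resolve_left fun he => hU e he hep, hep⟩

theorem not_obstructed_avoiding {n : ℕ} {S : Set (Fin n → ZMod 2)} (U : Finset (Fin n × Bool))
    (h : ¬ Obstructed (Hits S)) : ¬ Obstructed (Hits (avoiding S U)) := by
  rw [show Hits (avoiding S U) = fun T => Hits S (U ∪ T) from
    funext fun T => propext (hits_avoiding S U T)]
  exact fun h' => h h'.of_contract

/-- `μ` is a probability distribution on `S` for which the coordinates in `A` are unbiased. -/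
structure IsBalanced {n : ℕ} (S : Set (Fin n → ZMod 2)) (A : Finset (Fin n))
    (μ : (Fin n → ZMod 2) → ℝ) : Prop where
  nonneg : ∀ p, 0 ≤ μ p
  support : ∀ p, p ∉ S → μ p = 0
  total : ∑ p, μ p = 1
  unbiased : ∀ j ∈ A, ∑ p, μ p * chi (p j) = 0

theorem IsBalanced.sum_eq_of_const {n : ℕ} {S : Set (Fin n → ZMod 2)} {A : Finset (Fin n)}
    {μ : (Fin n → ZMod 2) → ℝ} (h : IsBalanced S A μ) {g : (Fin n → ZMod 2) → ℝ} {s : ℝ}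
    (hg : ∀ p ∈ S, g p = s) : ∑ p, μ p * g p = s := by
  have : ∀ p, μ p * g p = μ p * s := fun p => by
    by_cases hp : p ∈ S
    · rw [hg p hp]
    · rw [h.support p hp]; simp
  simp_rw [this]
  rw [← Finset.sum_mul, h.total, one_mul]

theorem IsBalanced.average {n : ℕ} {S S₁ S₂ : Set (Fin n → ZMod 2)} {A A' : Finset (Fin n)}
    {μ₁ μ₂ : (Fin n → ZMod 2) → ℝ} (h₁ : IsBalanced S₁ A' μ₁) (h₂ : IsBalanced S₂ A' μ₂)
    (hS₁ : S₁ ⊆ S) (hS₂ : S₂ ⊆ S) (hA : ∀ j ∈ A, j ∉ A' →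
      ∃ s, (∀ p ∈ S₁, chi (p j) = s) ∧ ∀ p ∈ S₂, chi (p j) = -s) :
    IsBalanced S A fun p => (μ₁ p + μ₂ p) / 2 where
  nonneg p := by have := h₁.nonneg p; have := h₂.nonneg p; positivity
  support p hp := by
    simp [h₁.support p fun h => hp (hS₁ h), h₂.support p fun h => hp (hS₂ h)]
  total := by rw [← Finset.sum_div, Finset.sum_add_distrib, h₁.total, h₂.total]; norm_num
  unbiased j hj := by
    have : ∀ p : Fin n → ZMod 2, (μ₁ p + μ₂ p) / 2 * chi (p j) =
        (μ₁ p * chi (p j) + μ₂ p * chi (p j)) / 2 := fun p => by ring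
    simp_rw [this]
    rw [← Finset.sum_div, Finset.sum_add_distrib]
    by_cases hjA : j ∈ A'
    · rw [h₁.unbiased j hjA, h₂.unbiased j hjA]; simp
    · obtain ⟨s, hs₁, hs₂⟩ := hA j hj hjA
      rw [h₁.sum_eq_of_const hs₁, h₂.sum_eq_of_const hs₂]; simp

theorem hits_pair {n : ℕ} (S : Set (Fin n → ZMod 2)) (j : Fin n) :
    Hits S {(j, true), (j, false)} := by
  intro p _
  rcases mem_cuboidMember_or p j with h | h
  · exact ⟨_, by simp, h⟩
  · exact ⟨_, by simp, h⟩

/-- If no coordinate in `A` is constant on `S` and the cuboid is unobstructed, then the center of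
the cube lies in the projection of the convex hull of `S` to the coordinates in `A`. -/
theorem exists_balanced {n : ℕ} (N : ℕ) : ∀ (S : Set (Fin n → ZMod 2)) (A : Finset (Fin n)),
    A.card ≤ N → S.Nonempty → (∀ j ∈ A, ∀ b, ¬ Hits S {(j, b)}) → ¬ Obstructed (Hits S) →
      ∃ μ, IsBalanced S A μ := by
  classical
  have hzero : ∀ S : Set (Fin n → ZMod 2), S.Nonempty → ∃ μ, IsBalanced S ∅ μ := by
    rintro S ⟨q, hq⟩
    refine ⟨fun p => if p = q then 1 else 0, fun p => by positivity, ?_, by simp, by simp⟩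
    intro p hp
    exact if_neg fun h : p = q => hp (h ▸ hq)
  induction N with
  | zero =>
    intro S A hA hS _ _
    obtain rfl : A = ∅ := by simpa using hA
    exact hzero S hS
  | succ N ih =>
    intro S A hAN hS hnc hobs
    rcases A.eq_empty_or_nonempty with rfl | ⟨i, hi⟩
    · exact hzero S hS
    have hs : ∀ y ∈ A ×ˢ (Finset.univ : Finset Bool), ¬ Hits S (insert y ∅) := by
      rintro ⟨j, b⟩ hy
      rw [Finset.mem_product] at hy
      simpa using hnc j hy.1 b
    set G := pairGraph (Hits S) ∅ (A ×ˢ (Finset.univ : Finset Bool)) with hG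
    have hcolor : G.Colorable 2 := by
      rw [SimpleGraph.two_colorable_iff_forall_loop_even]
      intro u w
      by_contra hodd
      exact hobs (obstructed_of_odd_closed_walk (hits_monotone S) hs w (Nat.not_even_iff_odd.mp hodd))
    obtain ⟨c⟩ : Nonempty (G.Coloring Bool) :=
      ⟨hcolor.toColoring (by simp)⟩
    -- The component of one literal. Opposite literals always form a cover, so it contains both
    -- literals or neither of each coordinate in `A`.
    set K := (A ×ˢ (Finset.univ : Finset Bool)).filter fun y => G.Reachable (i, true) y with hK
    have hKA : ∀ y ∈ K, y ∈ A ×ˢ (Finset.univ : Finset Bool) :=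
      fun y hy => (Finset.mem_filter.mp hy).1
    have hKadj : ∀ y ∈ K, ∀ z, G.Adj y z → z ∈ K := fun y hy z hA =>
      Finset.mem_filter.mpr ⟨hA.2.2.1, (Finset.mem_filter.mp hy).2.trans hA.reachable⟩
    have hiK : (i, true) ∈ K :=
      Finset.mem_filter.mpr ⟨by simp [hi], SimpleGraph.Reachable.refl _⟩
    have hflip : ∀ j ∈ A, G.Adj (j, true) (j, false) := fun j hj =>
      ⟨by simp, by simp [hj], by simp [hj], by simpa using hits_pair S j⟩
    have hmemK : ∀ j ∈ A, ∀ b, (j, b) ∈ K → (j, true) ∈ K ∧ (j, false) ∈ K := by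
      intro j hj b hb
      cases b
      · exact ⟨hKadj _ hb _ (hflip j hj).symm, hb⟩
      · exact ⟨hb, hKadj _ hb _ (hflip j hj)⟩
    have hcol : ∀ j ∈ A, c (j, true) ≠ c (j, false) := fun j hj => c.valid (hflip j hj)
    have hconn : ∀ I, ∀ x ∈ K, ∀ y ∈ K, (colorGraph (Hits S) I K c).Reachable x y := by
      intro I
      have hroot : ∀ x ∈ K, (colorGraph (Hits S) I K c).Reachable (i, true) x := by
        intro x hx
        refine ((Finset.mem_filter.mp hx).2.mem_of_closed
          (s := {x | x ∈ K ∧ (colorGraph (Hits S) I K c).Reachable (i, true) x}) ?_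
          ⟨hiK, SimpleGraph.Reachable.refl _⟩).2
        rintro y ⟨hy, hr⟩ z hA
        have hz := hKadj y hy z hA
        have hA' : (colorGraph (Hits S) I K c).Adj y z :=
          ⟨c.valid hA, hy, hz, hits_monotone S (by simp) hA.2.2.2⟩
        exact ⟨hz, hr.trans hA'.reachable⟩
      exact fun x hx y hy => (hroot x hx).symm.trans (hroot y hy)
    -- Used with `I` empty for nonemptiness of the two parts, and with `I` a literal outside `K` for
    -- nonconstancy of the remaining coordinates.
    have hclean : ∀ I, (∀ y ∈ K, ¬ Hits S (insert y I)) → ∀ b,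
        ¬ Hits S (I ∪ K.filter fun y => c y = b) := by
      intro I hI b hb
      refine hobs (obstructed_of_monochromatic (hits_monotone S) c K.card I K _ le_rfl hI
        (hconn I) (Finset.filter_subset _ K) ?_ ?_ hb)
      · have h1 := hmemK i hi true hiK
        by_cases h : c (i, true) = b
        · exact ⟨(i, true), Finset.mem_filter.mpr ⟨hiK, h⟩⟩
        · refine ⟨(i, false), Finset.mem_filter.mpr ⟨h1.2, ?_⟩⟩
          have := hcol i hi
          revert h this
          cases b <;> cases c (i, true) <;> cases c (i, false) <;> simp
      · intro x hx y hy
        rw [(Finset.mem_filter.mp hx).2, (Finset.mem_filter.mp hy).2]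
    have hrec : ∀ b, ∃ μ, IsBalanced (avoiding S (K.filter fun y => c y = b))
        (A.filter fun j => (j, true) ∉ K) μ := by
      intro b
      refine ih _ _ ?_ ?_ ?_ (not_obstructed_avoiding _ hobs)
      · have : (A.filter fun j => (j, true) ∉ K) ⊆ A.erase i := by
          intro j hj
          obtain ⟨hj, hjK⟩ := Finset.mem_filter.mp hj
          exact Finset.mem_erase.mpr ⟨fun e => hjK (e ▸ hiK), hj⟩
        have := Finset.card_le_card this
        rw [Finset.card_erase_of_mem hi] at this
        omega
      · by_contra hemp
        rw [Set.not_nonempty_iff_eq_empty] at hemp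
        refine hclean ∅ (fun y hy => hs y (hKA y hy)) b ?_
        have : Hits (avoiding S (K.filter fun y => c y = b)) ∅ := by
          rw [hemp]; simp [Hits]
        rw [hits_avoiding] at this
        simpa using this
      · intro j hj b' hb'
        obtain ⟨hj, hjK⟩ := Finset.mem_filter.mp hj
        rw [hits_avoiding] at hb'
        have hjb : (j, b') ∉ K := fun h => hjK (hmemK j hj b' h).1
        -- A literal of `K` that covers together with `(j, b')` would be adjacent to it and pull it
        -- into the component.
        refine hclean {(j, b')} ?_ b (hits_monotone S (by rw [Finset.union_comm]) hb')
        intro y hy hP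
        refine hjb (hKadj y hy _ ⟨fun e => hjb (e ▸ hy), hKA y hy, by simp [hj], ?_⟩)
        simpa using hP
    obtain ⟨μ₁, h₁⟩ := hrec true
    obtain ⟨μ₂, h₂⟩ := hrec false
    -- The colour classes contain opposite literals, so each coordinate of `K` is constant on both
    -- parts with opposite values and averages out.
    refine ⟨_, h₁.average h₂ (fun _ h => h.1) (fun _ h => h.1) fun j hj hjK => ?_⟩
    have hjK : (j, true) ∈ K := by
      by_contra h
      exact hjK (Finset.mem_filter.mpr ⟨hj, h⟩)
    have hjK' := (hmemK j hj true hjK).2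
    have hval : ∀ b, ∀ p ∈ avoiding S (K.filter fun y => c y = b),
        chi (p j) = if c (j, true) = b then 1 else -1 := by
      rintro b p ⟨-, hp⟩
      split_ifs with h
      · have := hp (j, true) (Finset.mem_filter.mpr ⟨hjK, h⟩)
        rw [true_mem_cuboidMember] at this
        simp [(zmod_two_eq_zero_or_one (p j)).resolve_right this]
      · have := hp (j, false) (Finset.mem_filter.mpr ⟨hjK', by
          have := hcol j hj
          revert h this
          cases b <;> cases c (j, true) <;> cases c (j, false) <;> simp⟩)
        rw [false_mem_cuboidMember] at this
        simp [(zmod_two_eq_zero_or_one (p j)).resolve_left this]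
    refine ⟨_, hval true, fun p hp => ?_⟩
    rw [hval false p hp]
    cases c (j, true) <;> simp

/-! ### Unique balanced distributions and their facets -/

/-- `μ` has support `S` and is the only probability distribution on `S` for which the coordinates
in `A` are unbiased. -/
structure IsUniquelyBalanced {n : ℕ} (S : Set (Fin n → ZMod 2)) (A : Finset (Fin n))
    (μ : (Fin n → ZMod 2) → ℝ) : Prop extends IsBalanced S A μ where
  pos : ∀ p ∈ S, 0 < μ p
  unique : ∀ ν, IsBalanced S A ν → ν = μ

/-- The coordinates `i` and `j` agree on `S`, up to complementing one of them. -/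
def Parallel {n : ℕ} (S : Set (Fin n → ZMod 2)) (i j : Fin n) : Prop :=
  ∃ s, ∀ p ∈ S, p i + p j = s

theorem chi_eq_of_add_eq {a b s : ZMod 2} (h : a + b = s) : chi b = chi s * chi a := by
  rw [← h, chi_add]
  linear_combination -(chi b) * chi_mul_self a

theorem mem_avoiding_true {n : ℕ} {S : Set (Fin n → ZMod 2)} {i : Fin n} {p : Fin n → ZMod 2} :
    p ∈ avoiding S {(i, true)} ↔ p ∈ S ∧ p i = 0 := by
  simp only [avoiding, Finset.mem_singleton, forall_eq, true_mem_cuboidMember, Set.mem_ofPred_eq]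
  rcases zmod_two_eq_zero_or_one (p i) with h | h <;> simp [h]

theorem mem_avoiding_false {n : ℕ} {S : Set (Fin n → ZMod 2)} {i : Fin n} {p : Fin n → ZMod 2} :
    p ∈ avoiding S {(i, false)} ↔ p ∈ S ∧ p i = 1 := by
  simp only [avoiding, Finset.mem_singleton, forall_eq, false_mem_cuboidMember, Set.mem_ofPred_eq]
  rcases zmod_two_eq_zero_or_one (p i) with h | h <;> simp [h]

theorem exists_sign_of_literal {n : ℕ} (e : Fin n × Bool) :
    ∃ s : ℝ, s * s = 1 ∧ ∀ p : Fin n → ZMod 2,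
      (e ∈ cuboidMember p → s * chi (p e.1) = 1) ∧
      (e ∉ cuboidMember p → s * chi (p e.1) = -1) := by
  obtain ⟨j, b⟩ := e
  cases b
  · refine ⟨1, by norm_num, fun p => ?_⟩
    rw [false_mem_cuboidMember]
    rcases zmod_two_eq_zero_or_one (p j) with h | h <;> simp [h]
  · refine ⟨-1, by norm_num, fun p => ?_⟩
    rw [true_mem_cuboidMember]
    rcases zmod_two_eq_zero_or_one (p j) with h | h <;> simp [h]

theorem parallel_of_chi {n : ℕ} {S : Set (Fin n → ZMod 2)} {i j : Fin n} {t : ℝ}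
    (h : ∀ p ∈ S, chi (p i) * chi (p j) = t) : Parallel S i j := by
  rcases S.eq_empty_or_nonempty with rfl | ⟨q, hq⟩
  · exact ⟨0, by simp⟩
  refine ⟨q i + q j, fun p hp => ?_⟩
  have h1 := (h p hp).trans (h q hq).symm
  rw [← chi_add, ← chi_add] at h1
  rcases zmod_two_eq_zero_or_one (p i + p j) with hp | hp <;>
    rcases zmod_two_eq_zero_or_one (q i + q j) with hq | hq <;>
    rw [hp, hq] at h1 ⊢ <;> norm_num at h1

/-- With a literal counted as `1` when true and `-1` when false, the two literals have nonnegative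
sum on `S` and mean zero. As `μ` is positive on `S`, the sum vanishes there, so exactly one literal
holds at each point. -/
theorem IsUniquelyBalanced.parallel_of_hits {n : ℕ} {S : Set (Fin n → ZMod 2)}
    {A : Finset (Fin n)} {μ : (Fin n → ZMod 2) → ℝ} (h : IsUniquelyBalanced S A μ)
    {e f : Fin n × Bool} (he : e.1 ∈ A) (hf : f.1 ∈ A) (hit : Hits S {e, f}) :
    Parallel S e.1 f.1 := by
  obtain ⟨s, hs, hse⟩ := exists_sign_of_literal e
  obtain ⟨t, ht, htf⟩ := exists_sign_of_literal f
  have hnn : ∀ p ∈ S, 0 ≤ s * chi (p e.1) + t * chi (p f.1) := by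
    intro p hp
    obtain ⟨g, hg, hgp⟩ := hit p hp
    simp only [Finset.mem_insert, Finset.mem_singleton] at hg
    rcases hg with rfl | rfl
    · rw [(hse p).1 hgp]
      by_cases hfp : f ∈ cuboidMember p
      · rw [(htf p).1 hfp]; norm_num
      · rw [(htf p).2 hfp]; norm_num
    · rw [(htf p).1 hgp]
      by_cases hep : e ∈ cuboidMember p
      · rw [(hse p).1 hep]; norm_num
      · rw [(hse p).2 hep]; norm_num
  have hsum : ∑ p, μ p * (s * chi (p e.1) + t * chi (p f.1)) = 0 := by
    have : ∀ p : Fin n → ZMod 2, μ p * (s * chi (p e.1) + t * chi (p f.1)) =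
        s * (μ p * chi (p e.1)) + t * (μ p * chi (p f.1)) := fun p => by ring
    simp_rw [this]
    rw [Finset.sum_add_distrib, ← Finset.mul_sum, ← Finset.mul_sum, h.unbiased _ he,
      h.unbiased _ hf]
    simp
  have hz := (Finset.sum_eq_zero_iff_of_nonneg fun p _ => by
    by_cases hp : p ∈ S
    · exact mul_nonneg (h.pos p hp).le (hnn p hp)
    · rw [h.support p hp, zero_mul]).mp hsum
  refine parallel_of_chi (t := -(s * t)) fun p hp => ?_
  have h1 := (mul_eq_zero.mp (hz p (Finset.mem_univ p))).resolve_left (h.pos p hp).ne'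
  linear_combination (s * chi (p f.1)) * h1 - chi (p e.1) * chi (p f.1) * hs -
    s * t * chi_mul_self (p f.1)

open Classical in
/-- The conditional distribution of `μ` on the facet `p i = 0` (`b = true`) or `p i = 1`
(`b = false`), when the coordinate `i` is unbiased. -/
noncomputable def facetDist {n : ℕ} (S : Set (Fin n → ZMod 2)) (μ : (Fin n → ZMod 2) → ℝ)
    (i : Fin n) (b : Bool) (p : Fin n → ZMod 2) : ℝ :=
  if p ∈ avoiding S {(i, b)} then 2 * μ p else 0

open Classical in
/-- The coordinates in `A` that are not parallel to `i`. -/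
noncomputable def transversal {n : ℕ} (S : Set (Fin n → ZMod 2)) (A : Finset (Fin n))
    (i : Fin n) : Finset (Fin n) :=
  A.filter fun j => ¬ Parallel S i j

/-- By `parallel_of_hits` no coordinate of the transversal is constant on a facet, so both facets
carry balanced distributions. Parallel coordinates have opposite constants on the facets, so any two
such distributions average to a balanced one on `S`, which must be `μ`; this determines each of
them. -/
theorem IsUniquelyBalanced.facet {n : ℕ} {S : Set (Fin n → ZMod 2)}
    {A : Finset (Fin n)} {μ : (Fin n → ZMod 2) → ℝ} (h : IsUniquelyBalanced S A μ)
    (hobs : ¬ Obstructed (Hits S)) {i : Fin n} (hi : i ∈ A) (b : Bool) :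
    IsUniquelyBalanced (avoiding S {(i, b)}) (transversal S A i) (facetDist S μ i b) := by
  classical
  have hmemT : ∀ j, j ∈ transversal S A i ↔ j ∈ A ∧ ¬ Parallel S i j := fun j => by
    simp [transversal]
  have hii : Parallel S i i := ⟨0, fun p _ => by
    rcases zmod_two_eq_zero_or_one (p i) with h | h <;> rw [h] <;> decide⟩
  have hex : ∀ b, ∃ ν, IsBalanced (avoiding S {(i, b)}) (transversal S A i) ν := by
    intro b
    refine exists_balanced _ _ _ le_rfl ?_ ?_ (not_obstructed_avoiding _ hobs)
    · by_contra hemp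
      rw [Set.not_nonempty_iff_eq_empty] at hemp
      obtain ⟨s, hs, hsp⟩ := exists_sign_of_literal (i, b)
      have h1 : ∀ p ∈ S, s * chi (p i) = 1 := by
        intro p hp
        refine (hsp p).1 ?_
        by_contra hn
        have : p ∈ avoiding S {(i, b)} := ⟨hp, by simpa using hn⟩
        rw [hemp] at this
        exact this
      have h2 := h.toIsBalanced.sum_eq_of_const h1
      have h3 : ∀ p : Fin n → ZMod 2, μ p * (s * chi (p i)) = s * (μ p * chi (p i)) :=
        fun p => by ring
      simp_rw [h3] at h2
      rw [← Finset.mul_sum, h.unbiased i hi] at h2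
      simp at h2
    · intro j hj b' hb'
      rw [hits_avoiding] at hb'
      exact ((hmemT j).mp hj).2 (h.parallel_of_hits (e := (i, b)) (f := (j, b')) hi
        ((hmemT j).mp hj).1 hb')
  have havg : ∀ ν₁ ν₂, IsBalanced (avoiding S {(i, true)}) (transversal S A i) ν₁ →
      IsBalanced (avoiding S {(i, false)}) (transversal S A i) ν₂ →
      (fun p => (ν₁ p + ν₂ p) / 2) = μ := by
    intro ν₁ ν₂ h₁ h₂
    refine h.unique _ (h₁.average h₂ (fun _ h => h.1) (fun _ h => h.1) fun j hj hjT => ?_)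
    have hpar : Parallel S i j := by
      by_contra hn
      exact hjT ((hmemT j).mpr ⟨hj, hn⟩)
    obtain ⟨s, hs⟩ := hpar
    refine ⟨chi s, fun p hp => ?_, fun p hp => ?_⟩
    · rw [mem_avoiding_true] at hp
      rw [chi_eq_of_add_eq (hs p hp.1), hp.2]; simp
    · rw [mem_avoiding_false] at hp
      rw [chi_eq_of_add_eq (hs p hp.1), hp.2]; simp
  have hfac : ∀ ν, IsBalanced (avoiding S {(i, b)}) (transversal S A i) ν →
      ν = facetDist S μ i b := by
    intro ν hν
    funext p
    rw [facetDist]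
    split_ifs with hp
    · obtain ⟨ν', hν'⟩ := hex (!b)
      cases b
      · have h1 := congrFun (havg ν' ν hν' hν) p
        have h2 := hν'.support p (by
          rw [mem_avoiding_false] at hp
          rw [Bool.not_false, mem_avoiding_true, hp.2]; simp)
        simp only [h2] at h1
        linarith
      · have h1 := congrFun (havg ν ν' hν hν') p
        have h2 := hν'.support p (by
          rw [mem_avoiding_true] at hp
          rw [Bool.not_true, mem_avoiding_false, hp.2]; simp)
        simp only [h2] at h1
        linarith
    · exact hν.support p hp
  obtain ⟨ν, hν⟩ := hex b
  refine ⟨hfac ν hν ▸ hν, fun p hp => ?_, hfac⟩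
  rw [facetDist, if_pos hp]
  exact mul_pos two_pos (h.pos p hp.1)

theorem IsBalanced.eq_facetDist_add {n : ℕ} {S : Set (Fin n → ZMod 2)}
    {A : Finset (Fin n)} {μ : (Fin n → ZMod 2) → ℝ} (h : IsBalanced S A μ) (i : Fin n)
    (p : Fin n → ZMod 2) : μ p = (facetDist S μ i true p + facetDist S μ i false p) / 2 := by
  rw [facetDist, facetDist, mem_avoiding_true, mem_avoiding_false]
  by_cases hp : p ∈ S
  · rcases zmod_two_eq_zero_or_one (p i) with hi | hi <;> simp [hp, hi]
  · simp [hp, h.support p hp]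

theorem IsBalanced.mul_chi_eq_facetDist_sub {n : ℕ} {S : Set (Fin n → ZMod 2)}
    {A : Finset (Fin n)} {μ : (Fin n → ZMod 2) → ℝ} (h : IsBalanced S A μ) (i : Fin n)
    (p : Fin n → ZMod 2) :
    μ p * chi (p i) = (facetDist S μ i true p - facetDist S μ i false p) / 2 := by
  rw [facetDist, facetDist, mem_avoiding_true, mem_avoiding_false]
  by_cases hp : p ∈ S
  · rcases zmod_two_eq_zero_or_one (p i) with hi | hi <;> simp [hp, hi, neg_div]
  · simp [hp, h.support p hp]

/-- Two coordinates that are not parallel are uncorrelated. -/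
theorem IsUniquelyBalanced.sum_mul_chi_mul_chi {n : ℕ} {S : Set (Fin n → ZMod 2)}
    {A : Finset (Fin n)} {μ : (Fin n → ZMod 2) → ℝ} (h : IsUniquelyBalanced S A μ)
    (hobs : ¬ Obstructed (Hits S)) {i j : Fin n} (hi : i ∈ A) (hj : j ∈ A)
    (hij : ¬ Parallel S i j) : ∑ p, μ p * (chi (p i) * chi (p j)) = 0 := by
  have hjT : j ∈ transversal S A i := by simp [transversal, hj, hij]
  have h1 := (h.facet hobs hi true).unbiased j hjT
  have h2 := (h.facet hobs hi false).unbiased j hjT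
  have h3 : ∀ p : Fin n → ZMod 2, μ p * (chi (p i) * chi (p j)) =
      (facetDist S μ i true p * chi (p j) - facetDist S μ i false p * chi (p j)) / 2 := fun p => by
    rw [← mul_assoc, h.toIsBalanced.mul_chi_eq_facetDist_sub i p]; ring
  simp_rw [h3]
  rw [← Finset.sum_div, Finset.sum_sub_distrib, h1, h2]
  simp

/-- Over an affinely independent set, the coordinates are closed under addition, up to constants. -/
theorem IsUniquelyBalanced.exists_add_const {n : ℕ} {S : Set (Fin n → ZMod 2)}
    {μ : (Fin n → ZMod 2) → ℝ} (h : IsUniquelyBalanced S Finset.univ μ)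
    (hobs : ¬ Obstructed (Hits S))
    (hind : ∀ ν : (Fin n → ZMod 2) → ℝ, (∀ p, p ∉ S → ν p = 0) → ∑ p, ν p = 0 →
      (∀ j, ∑ p, ν p * chi (p j) = 0) → ∀ p, ν p = 0)
    {i j : Fin n} (hij : ¬ Parallel S i j) : ∃ l s, ∀ p ∈ S, p i + p j + p l = s := by
  by_contra! hno
  have hpar : ∀ i j l, Parallel S i l → ∑ p, μ p * (chi (p i) * chi (p j)) * chi (p l) = 0 := by
    rintro i j l ⟨s, hs⟩
    have : ∀ p : Fin n → ZMod 2,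
        μ p * (chi (p i) * chi (p j)) * chi (p l) = chi s * (μ p * chi (p j)) := fun p => by
      by_cases hp : p ∈ S
      · rw [chi_eq_of_add_eq (hs p hp)]
        linear_combination (chi s * μ p * chi (p j)) * chi_mul_self (p i)
      · rw [h.support p hp]; simp
    simp_rw [this]
    rw [← Finset.mul_sum, h.unbiased j (Finset.mem_univ j), mul_zero]
  -- Third moments vanish. If `l` is parallel to neither `i` nor `j`, the moment is half the
  -- difference of the facet correlations of `j` and `l`, whose sum is zero because `j` and `l` are
  -- uncorrelated on `S`.
  have hcorr : ∀ l, ∑ p, μ p * (chi (p i) * chi (p j)) * chi (p l) = 0 := by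
    intro l
    by_cases hil : Parallel S i l
    · exact hpar i j l hil
    by_cases hjl : Parallel S j l
    · rw [← hpar j i l hjl]
      exact Finset.sum_congr rfl fun p _ => by ring
    have hjT : j ∈ transversal S Finset.univ i := by simp [transversal, hij]
    have hlT : l ∈ transversal S Finset.univ i := by simp [transversal, hil]
    have hX : ∀ b, Parallel (avoiding S {(i, b)}) j l ∨
        ∑ p, facetDist S μ i b p * (chi (p j) * chi (p l)) = 0 := fun b =>
      or_iff_not_imp_left.mpr fun hn =>
        (h.facet hobs (Finset.mem_univ i) b).sum_mul_chi_mul_chi (not_obstructed_avoiding _ hobs)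
          hjT hlT hn
    have hsum : ∑ p, facetDist S μ i true p * (chi (p j) * chi (p l)) +
        ∑ p, facetDist S μ i false p * (chi (p j) * chi (p l)) = 0 := by
      have h1 := h.sum_mul_chi_mul_chi hobs (Finset.mem_univ j) (Finset.mem_univ l) hjl
      have h2 : ∀ p : Fin n → ZMod 2, μ p * (chi (p j) * chi (p l)) =
          (facetDist S μ i true p * (chi (p j) * chi (p l)) +
            facetDist S μ i false p * (chi (p j) * chi (p l))) / 2 := fun p => by
        rw [h.toIsBalanced.eq_facetDist_add i p]; ring
      simp_rw [h2] at h1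
      rw [← Finset.sum_div, Finset.sum_add_distrib] at h1
      linarith
    have hgoal : ∑ p, μ p * (chi (p i) * chi (p j)) * chi (p l) =
        (∑ p, facetDist S μ i true p * (chi (p j) * chi (p l)) -
          ∑ p, facetDist S μ i false p * (chi (p j) * chi (p l))) / 2 := by
      rw [← Finset.sum_sub_distrib, Finset.sum_div]
      refine Finset.sum_congr rfl fun p _ => ?_
      have := h.toIsBalanced.mul_chi_eq_facetDist_sub i p
      linear_combination (chi (p j) * chi (p l)) * this
    rw [hgoal]
    rcases hX true with ⟨s, hs⟩ | hX₁
    · rcases hX false with ⟨t, ht⟩ | hX₂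
      -- Parallel on both facets, with opposite signs: then `p j + p l` equals `p i` up to a
      -- constant on all of `S`, and `l` is the excluded third coordinate.
      · exfalso
        have e1 := (h.facet hobs (Finset.mem_univ i) true).toIsBalanced.sum_eq_of_const
          (g := fun p => chi (p j) * chi (p l)) (s := chi s) fun p hp => by
            rw [← chi_add, hs p hp]
        have e2 := (h.facet hobs (Finset.mem_univ i) false).toIsBalanced.sum_eq_of_const
          (g := fun p => chi (p j) * chi (p l)) (s := chi t) fun p hp => by
            rw [← chi_add, ht p hp]
        rw [e1, e2] at hsum
        have hst : 1 + t = s := by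
          have h2 : (1 + 1 : ZMod 2) = 0 := by decide
          rcases zmod_two_eq_zero_or_one s with rfl | rfl <;>
            rcases zmod_two_eq_zero_or_one t with rfl | rfl <;> norm_num at hsum <;> simp [h2]
        obtain ⟨p, hp, hne⟩ := hno l s
        refine hne ?_
        rcases zmod_two_eq_zero_or_one (p i) with hpi | hpi
        · rw [hpi, zero_add, hs p (mem_avoiding_true.mpr ⟨hp, hpi⟩)]
        · rw [hpi, add_assoc, ht p (mem_avoiding_false.mpr ⟨hp, hpi⟩), hst]
      · linarith
    · linarith
  -- This signed measure has absolute value `μ`, so it cannot vanish on `S`.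
  have hz := hind (fun p => μ p * (chi (p i) * chi (p j)))
    (fun p hp => by simp [h.support p hp])
    (h.sum_mul_chi_mul_chi hobs (Finset.mem_univ i) (Finset.mem_univ j) hij) hcorr
  obtain ⟨p, hp, -⟩ := hno i 0
  have h1 := h.pos p hp
  have h2 := hz p
  have h3 : chi (p i) * chi (p j) * (chi (p i) * chi (p j)) = 1 := by
    linear_combination chi (p i) * chi (p i) * chi_mul_self (p j) + chi_mul_self (p i)
  have h4 : μ p = 0 := by linear_combination (chi (p i) * chi (p j)) * h2 - μ p * h3
  exact h1.ne' h4

/-! ### Identification with the cocycle space -/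

theorem sum_subtype_of_support {n : ℕ} {S : Set (Fin n → ZMod 2)} [Fintype S]
    {μ : (Fin n → ZMod 2) → ℝ} (h : ∀ p, p ∉ S → μ p = 0)
    (g : (Fin n → ZMod 2) → ℝ) : ∑ q : S, μ q * g q = ∑ p, μ p * g p := by
  classical
  rw [← Finset.sum_filter_of_ne (p := fun p => p ∈ S) fun p _ hp => by
    by_contra hn
    exact hp (by rw [h p hn, zero_mul])]
  exact (Finset.sum_subtype _ (by simp) fun p => μ p * g p).symm

theorem IsBalanced.not_const {n : ℕ} {S : Set (Fin n → ZMod 2)}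
    {A : Finset (Fin n)} {μ : (Fin n → ZMod 2) → ℝ} (h : IsBalanced S A μ) {i : Fin n}
    (hi : i ∈ A) (s : ZMod 2) : ¬ ∀ p ∈ S, p i = s := by
  intro hs
  have h1 := h.sum_eq_of_const (g := fun p => chi (p i)) (s := chi s) fun p hp => by rw [hs p hp]
  rw [h.unbiased i hi] at h1
  have h2 := chi_mul_self s
  rw [← h1] at h2
  norm_num at h2

/-- Translation by a vector on which the functional is `1` changes the sign of every term. -/
theorem sum_chi_eq_zero {V : Type*} [AddCommGroup V] [Module (ZMod 2) V] [Fintype V]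
    {φ : V →ₗ[ZMod 2] ZMod 2} (hφ : φ ≠ 0) : ∑ g, chi (φ g) = 0 := by
  obtain ⟨g₀, hg₀⟩ : ∃ g₀, φ g₀ ≠ 0 := by
    by_contra! h
    exact hφ (LinearMap.ext h)
  have h1 : φ g₀ = 1 := (zmod_two_eq_zero_or_one _).resolve_left hg₀
  have h2 : ∑ g, chi (φ (g + g₀)) = ∑ g, chi (φ g) :=
    Equiv.sum_comp (Equiv.addRight g₀) fun g => chi (φ g)
  simp_rw [map_add, chi_add, h1, chi_one, mul_neg_one, Finset.sum_neg_distrib] at h2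
  linarith

/-- The coordinate `i`, normalized to vanish at `p₀`, as a function on `S`. -/
def coordFun {n : ℕ} (S : Set (Fin n → ZMod 2)) (p₀ : Fin n → ZMod 2) (i : Fin n) :
    S → ZMod 2 := fun q => q.1 i + p₀ i

/-- The normalized coordinates together with zero, as a vector space. -/
def coordSpace {n : ℕ} (S : Set (Fin n → ZMod 2)) {p₀ : Fin n → ZMod 2} (hp₀ : p₀ ∈ S)
    (h : ∀ i j, ¬ Parallel S i j → ∃ l s, ∀ p ∈ S, p i + p j + p l = s) :
    Submodule (ZMod 2) (S → ZMod 2) where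
  carrier := {g | g = 0 ∨ ∃ i, g = coordFun S p₀ i}
  zero_mem' := Or.inl rfl
  add_mem' := by
    rintro _ _ (rfl | ⟨i, rfl⟩) (rfl | ⟨j, rfl⟩)
    · exact Or.inl (add_zero 0)
    · exact Or.inr ⟨j, zero_add _⟩
    · exact Or.inr ⟨i, add_zero _⟩
    have h2 : (2 : ZMod 2) = 0 := by decide
    by_cases hij : Parallel S i j
    · obtain ⟨s, hs⟩ := hij
      refine Or.inl (funext fun q => ?_)
      have h3 := hs q.1 q.2
      have h4 := hs p₀ hp₀
      change q.1 i + p₀ i + (q.1 j + p₀ j) = 0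
      linear_combination h3 + h4 + s * h2
    · obtain ⟨l, s, hs⟩ := h i j hij
      refine Or.inr ⟨l, funext fun q => ?_⟩
      have h3 := hs q.1 q.2
      have h4 := hs p₀ hp₀
      change q.1 i + p₀ i + (q.1 j + p₀ j) = q.1 l + p₀ l
      linear_combination h3 + h4 + (s - q.1 l - p₀ l) * h2
  smul_mem' := by
    intro c g hg
    rcases zmod_two_eq_zero_or_one c with rfl | rfl
    · exact Or.inl (zero_smul _ g)
    · rwa [one_smul]

/-- A basis of the coordinate space turns coordinates into columns: they are nonzero because no
coordinate is constant, and every nonzero vector occurs because the space has no other elements. The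
points of `S` become the linear functionals, that is, the rows. -/
theorem IsBalanced.exists_isDuplication {n : ℕ} (hn : 1 ≤ n) {S : Set (Fin n → ZMod 2)}
    {μ : (Fin n → ZMod 2) → ℝ} (hμ : IsBalanced S Finset.univ μ)
    (h : ∀ i j, ¬ Parallel S i j → ∃ l s, ∀ p ∈ S, p i + p j + p l = s) :
    ∃ k : ℕ, 1 ≤ k ∧ IsDuplication S (cocyclePG k) := by
  classical
  obtain ⟨p₀, hp₀⟩ : S.Nonempty := by
    by_contra hemp
    rw [Set.not_nonempty_iff_eq_empty] at hemp
    have := hμ.total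
    rw [Finset.sum_eq_zero fun p _ => hμ.support p (by simp [hemp])] at this
    norm_num at this
  set L := coordSpace S hp₀ h with hL
  have hmem : ∀ i, coordFun S p₀ i ∈ L := fun i => Or.inr ⟨i, rfl⟩
  have h2 : (2 : ZMod 2) = 0 := by decide
  have hne : ∀ i, (⟨coordFun S p₀ i, hmem i⟩ : L) ≠ 0 := by
    intro i hi
    refine hμ.not_const (Finset.mem_univ i) (p₀ i) fun p hp => ?_
    have : p i + p₀ i = 0 := congrFun (congrArg Subtype.val hi) ⟨p, hp⟩
    linear_combination this - p₀ i * h2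
  set φ := (Module.finBasis (ZMod 2) L).equivFun with hφ
  have hφne : ∀ i, φ ⟨coordFun S p₀ i, hmem i⟩ ≠ 0 := fun i => by
    rw [Ne, LinearEquiv.map_eq_zero_iff]
    exact hne i
  have hval : ∀ (y : Fin (Module.finrank (ZMod 2) L) → ZMod 2) a,
      ((pgMatrix _).transpose.mulVec y) a = ∑ j, a.1 j * y j := fun y a => rfl
  refine ⟨Module.finrank (ZMod 2) L, ?_, fun i => ⟨φ ⟨coordFun S p₀ i, hmem i⟩, hφne i⟩, ?_,
    p₀, ?_⟩
  · by_contra hk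
    have : IsEmpty (Fin (Module.finrank (ZMod 2) L)) := by
      rw [show Module.finrank (ZMod 2) L = 0 by omega]
      infer_instance
    exact hφne ⟨0, hn⟩ (Subsingleton.elim _ _)
  · rintro ⟨a, ha⟩
    obtain ⟨⟨g, hg⟩, rfl⟩ := φ.surjective a
    rcases hg with rfl | ⟨i, rfl⟩
    · exact absurd (map_zero φ) ha
    · exact ⟨i, rfl⟩
  · ext p
    constructor
    · intro hp
      set ψ : (Fin (Module.finrank (ZMod 2) L) → ZMod 2) →ₗ[ZMod 2] ZMod 2 :=
        (LinearMap.proj (⟨p, hp⟩ : S) ∘ₗ L.subtype) ∘ₗ φ.symm.toLinearMap with hψ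
      refine ⟨_, ⟨fun j => ψ fun j' => if j = j' then 1 else 0, rfl⟩, funext fun i => ?_⟩
      have h3 := LinearMap.pi_apply_eq_sum_univ ψ (φ ⟨coordFun S p₀ i, hmem i⟩)
      have h4 : ψ (φ ⟨coordFun S p₀ i, hmem i⟩) = p i + p₀ i := by
        simp [hψ, coordFun]
      simp only [smul_eq_mul] at h3
      simp only [hval]
      rw [← h3, h4]
      linear_combination p₀ i * h2
    · rintro ⟨_, ⟨y, rfl⟩, rfl⟩
      set ψ : L →ₗ[ZMod 2] ZMod 2 :=
        (∑ j, y j • LinearMap.proj j) ∘ₗ φ.toLinearMap with hψ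
      have hψv : ∀ g, ψ g = ∑ j, φ g j * y j := fun g => by
        simp [hψ, mul_comm]
      -- If `ψ` differed from every evaluation, the character sums over `L` would vanish for each
      -- `q`. Averaging over `μ` and exchanging sums leaves only the term `g = 0`, since the other
      -- elements of `L` are unbiased, and this term is `1`.
      obtain ⟨q, hq⟩ : ∃ q : S, ∀ g : L, ψ g = g.1 q := by
        by_contra! hno
        have hF : ∀ q : S, ∑ g : L, chi (ψ g) * chi (g.1 q) = 0 := by
          intro q
          obtain ⟨g, hg⟩ := hno q
          rw [← sum_chi_eq_zero (φ := ψ + LinearMap.proj q ∘ₗ L.subtype) fun h0 => hg ?_]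
          · exact Finset.sum_congr rfl fun g _ => (chi_add _ _).symm
          · have : ψ g + g.1 q = 0 := LinearMap.congr_fun h0 g
            linear_combination this - g.1 q * h2
        have hsum : ∑ g : L, chi (ψ g) * ∑ q : S, μ q * chi (g.1 q) = 0 := by
          simp_rw [Finset.mul_sum]
          rw [Finset.sum_comm]
          refine Finset.sum_eq_zero fun q _ => ?_
          have : ∑ g : L, chi (ψ g) * (μ q * chi (g.1 q)) =
              μ q * ∑ g : L, chi (ψ g) * chi (g.1 q) := by
            rw [Finset.mul_sum]
            exact Finset.sum_congr rfl fun g _ => by ring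
          rw [this, hF q, mul_zero]
        rw [Finset.sum_eq_single 0] at hsum
        · have := sum_subtype_of_support hμ.support fun _ => 1
          simp only [mul_one, hμ.total] at this
          simp [this] at hsum
        · rintro ⟨g, hg⟩ - hg0
          rcases hg with rfl | ⟨i, rfl⟩
          · exact absurd rfl hg0
          · have := sum_subtype_of_support hμ.support fun p => chi (p i + p₀ i)
            simp only [coordFun]
            rw [this]
            simp_rw [chi_add, ← mul_assoc]
            rw [← Finset.sum_mul, hμ.unbiased i (Finset.mem_univ i)]
            simp
        · simp
      have : (fun i => (pgMatrix _).transpose.mulVec y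
          ⟨φ ⟨coordFun S p₀ i, hmem i⟩, hφne i⟩ + p₀ i) = q.1 := by
        funext i
        have h3 := hq ⟨coordFun S p₀ i, hmem i⟩
        rw [hψv] at h3
        rw [hval, h3]
        change q.1 i + p₀ i + p₀ i = q.1 i
        linear_combination p₀ i * h2
      have h5 := q.2
      rw [← this] at h5
      exact h5

/-! ### From the simplex to a uniquely balanced distribution -/

theorem toRealPoint_eq_chi {n : ℕ} (p : Fin n → ZMod 2) (j : Fin n) :
    toRealPoint p j = (1 - chi (p j)) / 2 := by
  rw [toRealPoint]
  rcases zmod_two_eq_zero_or_one (p j) with h | h <;> rw [h]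
  · simp
  · simp [ZMod.val_one]

theorem toRealPoint_injective {n : ℕ} :
    Function.Injective (toRealPoint : (Fin n → ZMod 2) → Fin n → ℝ) := by
  intro p q h
  funext i
  have := congrFun h i
  simp only [toRealPoint, Nat.cast_inj] at this
  exact ZMod.val_injective 2 this

theorem mem_Icc_of_mem_realConvexHull {n : ℕ} {S : Set (Fin n → ZMod 2)} {x : Fin n → ℝ}
    (hx : x ∈ realConvexHull S) : x ∈ Set.Icc (0 : Fin n → ℝ) 1 := by
  refine convexHull_min ?_ (convex_Icc (0 : Fin n → ℝ) 1) hx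
  rintro _ ⟨p, -, rfl⟩
  constructor <;> intro j <;> simp only [toRealPoint, Pi.zero_apply, Pi.one_apply]
  · positivity
  · have := ZMod.val_lt (p j)
    exact_mod_cast (by omega : (p j).val ≤ 1)

/-- The hull lies in the unit cube, of which every 0-1 point is a vertex. -/
theorem toRealPoint_mem_extremePoints {n : ℕ} {S : Set (Fin n → ZMod 2)} {p : Fin n → ZMod 2}
    (hp : p ∈ S) : toRealPoint p ∈ (realConvexHull S).extremePoints ℝ := by
  rw [mem_extremePoints]
  refine ⟨subset_convexHull ℝ _ ⟨p, hp, rfl⟩, ?_⟩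
  rintro x hx y hy ⟨a, b, ha, hb, hab, hxy⟩
  obtain ⟨hx0, hx1⟩ := mem_Icc_of_mem_realConvexHull hx
  obtain ⟨hy0, hy1⟩ := mem_Icc_of_mem_realConvexHull hy
  have key : ∀ j, x j = toRealPoint p j ∧ y j = toRealPoint p j := by
    intro j
    have h := congrFun hxy j
    have h1 := hx0 j
    have h2 := hx1 j
    have h3 := hy0 j
    have h4 := hy1 j
    simp only [Pi.add_apply, Pi.smul_apply, smul_eq_mul, Pi.zero_apply, Pi.one_apply] at h h1 h2 h3 h4
    rw [toRealPoint_eq_chi] at h ⊢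
    obtain rfl : b = 1 - a := by linarith
    rcases zmod_two_eq_zero_or_one (p j) with hj | hj <;> rw [hj] at h ⊢
    · rw [chi_zero] at h ⊢
      constructor <;> nlinarith [mul_nonneg ha.le h1, mul_nonneg hb.le h3]
    · rw [chi_one] at h ⊢
      constructor <;> nlinarith [mul_nonneg ha.le (sub_nonneg.mpr h2),
        mul_nonneg hb.le (sub_nonneg.mpr h4)]
  exact ⟨funext fun j => (key j).1, funext fun j => (key j).2⟩

/-- The vertices of the simplex are not given as points of `S`, but extreme points of a hull lie
among its generators, so `S` sits inside an affinely independent set. -/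
theorem affineIndependent_of_isSimplex {n : ℕ} {S : Set (Fin n → ZMod 2)}
    (h : IsSimplex (realConvexHull S)) : AffineIndependent ℝ fun p : S => toRealPoint p.1 := by
  obtain ⟨d, v, hv, hS⟩ := h
  refine AffineIndependent.of_set_of_injective ?_ fun p q hpq =>
    Subtype.ext (toRealPoint_injective hpq)
  refine hv.range.mono ?_
  rintro _ ⟨p, rfl⟩
  have := toRealPoint_mem_extremePoints p.2
  rw [hS] at this
  exact extremePoints_convexHull_subset this

theorem eq_zero_of_sum_mul_chi {n : ℕ} {S : Set (Fin n → ZMod 2)}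
    (h : IsSimplex (realConvexHull S)) (ν : (Fin n → ZMod 2) → ℝ) (hν : ∀ p, p ∉ S → ν p = 0)
    (h0 : ∑ p, ν p = 0) (hj : ∀ j, ∑ p, ν p * chi (p j) = 0) (p : Fin n → ZMod 2) : ν p = 0 := by
  classical
  by_cases hp : p ∈ S
  · refine affineIndependent_iff.mp (affineIndependent_of_isSimplex h) Finset.univ
      (fun q : S => ν q) ?_ ?_ ⟨p, hp⟩ (Finset.mem_univ _)
    · have := sum_subtype_of_support hν fun _ => 1
      simpa [h0] using this
    · funext j
      have := sum_subtype_of_support hν fun p => (1 - chi (p j)) / 2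
      simp only [Finset.sum_apply, Pi.smul_apply, smul_eq_mul, toRealPoint_eq_chi, Pi.zero_apply]
      rw [this]
      have h1 : ∀ p : Fin n → ZMod 2, ν p * ((1 - chi (p j)) / 2) =
          (ν p - ν p * chi (p j)) / 2 := fun p => by ring
      simp_rw [h1]
      rw [← Finset.sum_div, Finset.sum_sub_distrib, h0, hj j]
      simp
  · exact hν p hp

theorem exists_weights_of_mem_realConvexHull {n : ℕ} {S : Set (Fin n → ZMod 2)} {x : Fin n → ℝ}
    (hx : x ∈ realConvexHull S) : ∃ μ : (Fin n → ZMod 2) → ℝ, (∀ p, 0 ≤ μ p) ∧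
      (∀ p, p ∉ S → μ p = 0) ∧ ∑ p, μ p = 1 ∧ ∀ j, ∑ p, μ p * chi (p j) = 1 - 2 * x j := by
  classical
  refine convexHull_min (t := {x | ∃ μ : (Fin n → ZMod 2) → ℝ, (∀ p, 0 ≤ μ p) ∧
      (∀ p, p ∉ S → μ p = 0) ∧ ∑ p, μ p = 1 ∧ ∀ j, ∑ p, μ p * chi (p j) = 1 - 2 * x j}) ?_ ?_ hx
  · rintro _ ⟨q, hq, rfl⟩
    refine ⟨fun p => if p = q then 1 else 0, fun p => by positivity, ?_, by simp, fun j => ?_⟩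
    · intro p hp
      exact if_neg fun h : p = q => hp (h ▸ hq)
    · rw [toRealPoint_eq_chi]
      simp
      ring
  · rintro x ⟨μ, h1, h2, h3, h4⟩ y ⟨ν, k1, k2, k3, k4⟩ a b ha hb hab
    refine ⟨fun p => a * μ p + b * ν p, fun p => ?_, fun p hp => by simp [h2 p hp, k2 p hp], ?_,
      fun j => ?_⟩
    · have := h1 p
      have := k1 p
      positivity
    · rw [Finset.sum_add_distrib, ← Finset.mul_sum, ← Finset.mul_sum, h3, k3]
      linarith
    · have e : ∀ p : Fin n → ZMod 2, (a * μ p + b * ν p) * chi (p j) =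
          a * (μ p * chi (p j)) + b * (ν p * chi (p j)) := fun p => by ring
      simp_rw [e]
      rw [Finset.sum_add_distrib, ← Finset.mul_sum, ← Finset.mul_sum, h4, k4]
      simp only [Pi.add_apply, Pi.smul_apply, smul_eq_mul]
      linear_combination hab

theorem exists_pos_lineMap_mem_of_mem_intrinsicInterior {E : Type*} [NormedAddCommGroup E]
    [NormedSpace ℝ E] {K : Set E} {c q : E} (hc : c ∈ intrinsicInterior ℝ K) (hq : q ∈ K) :
    ∃ ε : ℝ, 0 < ε ∧ AffineMap.lineMap c q (-ε) ∈ K := by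
  obtain ⟨y, hy, rfl⟩ := mem_intrinsicInterior.mp hc
  let g : ℝ → affineSpan ℝ K := fun t =>
    ⟨AffineMap.lineMap (y : E) q t,
      AffineMap.lineMap_mem t y.2 (subset_affineSpan ℝ K hq)⟩
  have hg : Continuous g :=
    Continuous.subtype_mk (AffineMap.lineMap_continuous) _
  have hg0 : g 0 = y := Subtype.ext (AffineMap.lineMap_apply_zero _ _)
  have hnhds : ∀ᶠ t in nhds (0 : ℝ), g t ∈ ((↑) ⁻¹' K : Set (affineSpan ℝ K)) := by
    refine hg.continuousAt.eventually ?_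
    rw [hg0]
    exact mem_interior_iff_mem_nhds.mp hy
  obtain ⟨δ, hδ, hball⟩ := Metric.eventually_nhds_iff.mp hnhds
  refine ⟨δ / 2, by positivity, hball ?_⟩
  rw [Real.dist_eq, sub_zero, abs_neg, abs_of_pos (by positivity)]
  linarith

theorem exists_isUniquelyBalanced {n : ℕ} {S : Set (Fin n → ZMod 2)}
    (hsimplex : IsSimplex (realConvexHull S))
    (hhalf : (fun _ => 1 / 2 : Fin n → ℝ) ∈ intrinsicInterior ℝ (realConvexHull S)) :
    ∃ μ, IsUniquelyBalanced S Finset.univ μ := by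
  classical
  have huniq : ∀ μ ν, IsBalanced S Finset.univ μ → IsBalanced S Finset.univ ν → ν = μ := by
    intro μ ν hμ hν
    funext p
    have := eq_zero_of_sum_mul_chi hsimplex (fun p => ν p - μ p)
      (fun p hp => by simp [hμ.support p hp, hν.support p hp])
      (by rw [Finset.sum_sub_distrib, hμ.total, hν.total, sub_self])
      (fun j => by
        simp_rw [sub_mul]
        rw [Finset.sum_sub_distrib, hμ.unbiased j (Finset.mem_univ j),
          hν.unbiased j (Finset.mem_univ j), sub_self]) p
    linarith
  obtain ⟨μ, h1, h2, h3, h4⟩ :=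
    exists_weights_of_mem_realConvexHull (intrinsicInterior_subset hhalf)
  have hμ : IsBalanced S Finset.univ μ := ⟨h1, h2, h3, fun j _ => by rw [h4]; norm_num⟩
  refine ⟨μ, hμ, fun q hq => ?_, fun ν hν => huniq μ ν hμ hν⟩
  obtain ⟨ε, hε, hz⟩ := exists_pos_lineMap_mem_of_mem_intrinsicInterior hhalf
    (subset_convexHull ℝ _ ⟨q, hq, rfl⟩)
  obtain ⟨ν, k1, k2, k3, k4⟩ := exists_weights_of_mem_realConvexHull hz
  -- The prolonged point is `(1 + ε)` times the centre minus `ε` times `q`. Solving for the centre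
  -- gives these weights, with positive mass at `q`.
  have hν : IsBalanced S Finset.univ
      fun p => (ν p + ε * if p = q then 1 else 0) / (1 + ε) := by
    refine ⟨fun p => ?_, fun p hp => ?_, ?_, fun j _ => ?_⟩
    · have := k1 p
      positivity
    · rw [k2 p hp, if_neg fun h : p = q => hp (h ▸ hq)]
      simp
    · rw [← Finset.sum_div, Finset.sum_add_distrib, k3, ← Finset.mul_sum]
      simp only [Finset.sum_ite_eq', Finset.mem_univ, if_true, mul_one]
      exact div_self (by positivity)
    · have e : ∀ p : Fin n → ZMod 2, (ν p + ε * if p = q then 1 else 0) / (1 + ε) * chi (p j) =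
          (ν p * chi (p j) + ε * if p = q then chi (p j) else 0) / (1 + ε) := fun p => by
        split_ifs <;> ring
      simp_rw [e]
      rw [← Finset.sum_div, Finset.sum_add_distrib, k4, ← Finset.mul_sum]
      simp only [Finset.sum_ite_eq', Finset.mem_univ, if_true, AffineMap.lineMap_apply,
        vsub_eq_sub, vadd_eq_add, Pi.add_apply, Pi.smul_apply, Pi.sub_apply, smul_eq_mul,
        toRealPoint_eq_chi]
      ring
  rw [← huniq μ _ hμ hν]
  have := k1 q
  simp only [if_true]
  positivity

/-! ### Binary clutters and the exclusion of both alternatives -/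

namespace Clutter

/-- A clutter whose members are the minimal sets of a family that is closed under the symmetric
difference of three sets. -/
def IsBinary {α : Type*} [DecidableEq α] (C : Clutter α) : Prop :=
  ∃ L : Set (Finset α), (∀ X ∈ L, ∀ Y ∈ L, ∀ Z ∈ L, symmDiff (symmDiff X Y) Z ∈ L) ∧
    C.members ⊆ L ∧ ∀ X ∈ L, ∃ A ∈ C.members, A ⊆ X

theorem IsBinary.minor {α : Type*} [DecidableEq α] {C : Clutter α} (h : C.IsBinary)
    (I J : Finset α) : (C.minor I J).IsBinary := by
  obtain ⟨L, hL, hCL, hLC⟩ := h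
  refine ⟨{Y | ∃ X ∈ L, Disjoint X I ∧ Y = X \ J}, ?_, ?_, ?_⟩
  · rintro _ ⟨X, hX, hXI, rfl⟩ _ ⟨Y, hY, hYI, rfl⟩ _ ⟨Z, hZ, hZI, rfl⟩
    refine ⟨_, hL X hX Y hY Z hZ, ?_, ?_⟩
    · rw [Finset.disjoint_left] at hXI hYI hZI ⊢
      intro x hx
      simp only [Finset.mem_symmDiff] at hx
      have := @hXI x
      have := @hYI x
      have := @hZI x
      tauto
    · ext x
      simp only [Finset.mem_symmDiff, Finset.mem_sdiff]
      tauto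
  · intro B hB
    obtain ⟨A, hA, hAI, rfl⟩ := Minimal.prop hB
    exact ⟨A, hCL hA, hAI, rfl⟩
  · rintro _ ⟨X, hX, hXI, rfl⟩
    obtain ⟨A, hA, hAX⟩ := hLC X hX
    obtain ⟨B, hB, hm⟩ := exists_minimal_le_of_wellFoundedLT (C.IsRemnant I J) (A \ J)
      ⟨A, hA, Finset.disjoint_of_subset_left hAX hXI, rfl⟩
    exact ⟨B, hm, hB.trans (Finset.sdiff_subset_sdiff hAX subset_rfl)⟩

/-- The sum of `{a, b}`, `{a, c}` and the long member omits `a` and `b`, so it contains no member.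
-/
theorem IsBinary.not_isDelta {α : Type*} [DecidableEq α] {C : Clutter α} (h : C.IsBinary) :
    ¬ C.IsDelta := by
  rintro ⟨h3, a, ha, hC⟩
  obtain ⟨L, hL, hCL, hLC⟩ := h
  obtain ⟨b, hb, c, hc, hbc⟩ : ∃ b ∈ C.ground.erase a, ∃ c ∈ C.ground.erase a, b ≠ c :=
    Finset.one_lt_card.mp (by rw [Finset.card_erase_of_mem ha]; omega)
  have hpair : ∀ d ∈ C.ground.erase a, {a, d} ∈ L := fun d hd =>
    hCL (by rw [hC]; exact Or.inr ⟨d, hd, rfl⟩)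
  obtain ⟨A, hA, hAX⟩ := hLC _ (hL _ (hpair b hb) _ (hpair c hc) (C.ground.erase a)
    (hCL (by rw [hC]; exact Or.inl rfl)))
  have hab := (Finset.mem_erase.mp hb).1
  rw [hC] at hA
  rcases hA with rfl | ⟨d, hd, rfl⟩
  · have := hAX hb
    simp only [Finset.mem_symmDiff, Finset.mem_insert, Finset.mem_singleton] at this
    tauto
  · have := hAX (Finset.mem_insert_self a _)
    simp [Finset.mem_symmDiff] at this

/-- Every set of the family `L` meets each edge of the cycle in exactly one end: if it contained
both, adding two sets that each miss a different end would give a set missing both. Membership would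
then alternate around an odd cycle. -/
theorem IsBinary.not_isBlockerOfExtendedOddHole {α : Type*} [DecidableEq α] {D : Clutter α}
    (h : D.IsBinary) : ¬ D.IsBlockerOfExtendedOddHole := by
  rintro ⟨C, ⟨n, h5, hn, a, ha, hW, hC⟩, rfl⟩
  obtain ⟨L, hL, hCL, hLC⟩ := h
  have : Fact (1 < n) := ⟨by omega⟩
  have hne : ∀ i, a i ≠ a (i + 1) := fun i h => by simpa using ha h
  have hedge : ∀ i, {a i, a (i + 1)} ∈ C.members ∧
      ∀ B ∈ C.members, ({a i, a (i + 1)} : Finset α).card ≤ B.card := by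
    intro i
    have : ({a i, a (i + 1)} : Finset α) ∈ {A | ∃ i, A = {a i, a (i + 1)}} := ⟨i, rfl⟩
    rw [← hC] at this
    exact this
  have hcov : ∀ i (X : Finset α), (∀ x ∈ ({a i, a (i + 1)} : Finset α), x ∉ X) → X ∉ L := by
    intro i X hX hXL
    obtain ⟨A, hA, hAX⟩ := hLC X hXL
    obtain ⟨x, hx⟩ := (Minimal.prop hA).2 _ (hedge i).1
    rw [Finset.mem_inter] at hx
    exact hX x hx.1 (hAX hx.2)
  have hmiss : ∀ x, ∃ A ∈ L, x ∉ A := by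
    intro x
    have hc : C.IsCover (C.ground.erase x) := by
      refine ⟨Finset.erase_subset _ _, fun B hB => ?_⟩
      have h2 := (hedge 0).2 B hB
      rw [Finset.card_pair (hne 0)] at h2
      obtain ⟨y, hy, hyx⟩ := Finset.exists_mem_ne (s := B) (by omega) x
      exact ⟨y, by simp [hy, hyx, C.subset_ground B hB hy]⟩
    obtain ⟨A, hA, hAx⟩ := hc.exists_blocker_subset
    exact ⟨A, hCL hA, fun h => Finset.notMem_erase x _ (hAx h)⟩
  have halt : ∀ X ∈ L, ∀ i, a (i + 1) ∈ X ↔ a i ∉ X := by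
    intro X hX i
    constructor
    · intro h1 h0
      obtain ⟨A, hA, hA0⟩ := hmiss (a (i + 1))
      obtain ⟨B, hB, hB1⟩ := hmiss (a i)
      have hA' : a i ∈ A := by
        by_contra hn
        exact hcov i A (by simp [hn, hA0]) hA
      have hB' : a (i + 1) ∈ B := by
        by_contra hn
        exact hcov i B (by simp [hn, hB1]) hB
      exact hcov i _ (by simp [Finset.mem_symmDiff, h0, h1, hA0, hA', hB1, hB'])
        (hL X hX A hA B hB)
    · intro h0
      by_contra h1
      exact hcov i X (by simp [h0, h1]) hX
  obtain ⟨X, hX, -⟩ := hmiss (a 0)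
  have hpar : ∀ m : ℕ, a (m : ZMod n) ∈ X ↔ (Even m ↔ a 0 ∈ X) := by
    intro m
    induction m with
    | zero => simp
    | succ m ih =>
      rw [Nat.cast_succ, halt X hX, ih, Nat.even_add_one]
      tauto
  have := hpar n
  rw [ZMod.natCast_self, ← Nat.not_odd_iff_even] at this
  tauto

end Clutter

/-- The number of summands is odd, so the complemented coordinates add up in the same way as the
coordinates. -/
theorem cuboidMember_add_add {n : ℕ} (p q r : Fin n → ZMod 2) :
    cuboidMember (p + q + r) =
      symmDiff (symmDiff (cuboidMember p) (cuboidMember q)) (cuboidMember r) := by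
  ext ⟨j, b⟩
  have h : ∀ (x y z : ZMod 2) (b : Bool), x + y + z = (if b then 1 else 0) ↔
      ((x = if b then 1 else 0) ∧ ¬ (y = if b then 1 else 0) ∨
        (y = if b then 1 else 0) ∧ ¬ (x = if b then 1 else 0)) ∧ ¬ (z = if b then 1 else 0) ∨
      (z = if b then 1 else 0) ∧ ¬ ((x = if b then 1 else 0) ∧ ¬ (y = if b then 1 else 0) ∨
        (y = if b then 1 else 0) ∧ ¬ (x = if b then 1 else 0)) := by decide
  simp only [Finset.mem_symmDiff, cuboidMember, Finset.mem_filter, Finset.mem_univ, true_and,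
    Pi.add_apply]
  exact h _ _ _ _

theorem cuboid_isBinary {n : ℕ} {S : Set (Fin n → ZMod 2)}
    (h : ∀ p ∈ S, ∀ q ∈ S, ∀ r ∈ S, p + q + r ∈ S) : (cuboid S).IsBinary := by
  refine ⟨cuboidMember '' S, ?_, subset_rfl, fun X hX => ⟨X, hX, subset_rfl⟩⟩
  rintro _ ⟨p, hp, rfl⟩ _ ⟨q, hq, rfl⟩ _ ⟨r, hr, rfl⟩
  exact ⟨_, h p hp q hq r hr, cuboidMember_add_add p q r⟩

theorem IsDuplication.add_add_mem {n k : ℕ} {S : Set (Fin n → ZMod 2)}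
    (h : IsDuplication S (cocyclePG k)) : ∀ p ∈ S, ∀ q ∈ S, ∀ r ∈ S, p + q + r ∈ S := by
  obtain ⟨f, -, t, rfl⟩ := h
  rintro _ ⟨_, ⟨x, rfl⟩, rfl⟩ _ ⟨_, ⟨y, rfl⟩, rfl⟩ _ ⟨_, ⟨z, rfl⟩, rfl⟩
  refine ⟨_, ⟨x + y + z, rfl⟩, funext fun i => ?_⟩
  have h2 : (2 : ZMod 2) = 0 := by decide
  simp only [Matrix.mulVec_add, Pi.add_apply]
  linear_combination -t i * h2

theorem mainTheorem5 (n : ℕ) (hn : 1 ≤ n) (S : Set (Fin n → ZMod 2))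
    (hsimplex : IsSimplex (realConvexHull S))
    (hhalf : (fun _ => 1 / 2 : Fin n → ℝ) ∈ intrinsicInterior ℝ (realConvexHull S)) :
    ((cuboid S).HasMinor
        (fun D => D.IsDelta ∨ D.IsBlockerOfExtendedOddHole) ∨
      ∃ k : ℕ, 1 ≤ k ∧ IsDuplication S (cocyclePG k)) ∧
    ¬ ((cuboid S).HasMinor
        (fun D => D.IsDelta ∨ D.IsBlockerOfExtendedOddHole) ∧
      ∃ k : ℕ, 1 ≤ k ∧ IsDuplication S (cocyclePG k)) := by
  constructor
  · by_cases hobs : Obstructed (Hits S)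
    · refine Or.inl (Clutter.hasMinor_of_obstructed rfl ?_)
      have heq : (fun T => ∀ A ∈ (cuboid S).members, (A ∩ T).Nonempty) = Hits S := by
        refine funext fun T => propext ⟨fun h p hp => ?_, ?_⟩
        · obtain ⟨e, he⟩ := h _ ⟨p, hp, rfl⟩
          exact ⟨e, (Finset.mem_inter.mp he).2, (Finset.mem_inter.mp he).1⟩
        · rintro h _ ⟨p, hp, rfl⟩
          obtain ⟨e, heT, hep⟩ := h p hp
          exact ⟨e, Finset.mem_inter.mpr ⟨hep, heT⟩⟩
      rwa [heq]
    · obtain ⟨μ, hμ⟩ := exists_isUniquelyBalanced hsimplex hhalf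
      exact Or.inr (hμ.toIsBalanced.exists_isDuplication hn fun i j hij =>
        hμ.exists_add_const hobs (eq_zero_of_sum_mul_chi hsimplex) hij)
  · rintro ⟨⟨I, J, -, -, -, hD⟩, k, -, hdup⟩
    have hbin := (cuboid_isBinary hdup.add_add_mem).minor I J
    exact hD.elim hbin.not_isDelta hbin.not_isBlockerOfExtendedOddHole
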